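/- **Proposition 5.5.** Let $R$ be a commutative artinian ring, let $I$ be an injective envelope of the $R$-module $R/\operatorname{rad}(R)$, and let $A$ be an $R$-algebra that is finitely generated as an $R$-module. Write $\operatorname{Mod}A$ for the category of left $A$-modules, $\operatorname{mod}A$ for its full subcategory of finitely generated modules, and $DA=\operatorname{Hom}_R(A,I)$, an $A$-$A$-bimodule. Let $d\colon P^{-1}\to P^{0}$ be a homomorphism between finitely generated projective left $A$-modules, and let $P^\bullet$ be its mapping cone, i.e. the complex $P^{-1}\to P^0$ with $P^{-1}$ in degree $-1$ and $P^0$ in degree $0$. Put $$\mathcal X_c=\{X\in\operatorname{mod}A:\operatorname{Hom}_{D(\operatorname{Mod}A)}(P^\bullet,X[1])=0\},\qquad \mathcal Y_c=\{X\in\operatorname{mod}A:\operatorname{Hom}_{D(\operatorname{Mod}A)}(P^\bullet,X)=0\}.$$ Let $K^b(\operatorname{proj}A)$ be the homotopy category of bounded complexes of finitely generated projective left $A$-modules. A complex $T\in K^b(\operatorname{proj}A)$ is a *tilting complex* if $\operatorname{Hom}(T,T[i])=0$ for all integers $i\neq0$ and $\operatorname{add}(T)$, the class of direct summands of finite direct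 sums of copies of $T$, generates $K^b(\operatorname{proj}A)$ as a triangulated category. A pair $(\mathcal X,\mathcal Y)$ of full subcategories of an abelian category is a *torsion theory* if $\mathcal X\cap\mathcal Y=\{0\}$, $\mathcal X$ is closed under factor objects, $\mathcal Y$ is closed under subobjects, and every object $Z$ admits an exact sequence $0\to Z'\to Z\to Z''\to0$ with $Z'\in\mathcal X$ and $Z''\in\mathcal Y$. The following are equivalent: 1. $P^\bullet$ is a tilting complex. 2. $\mathcal X_c\cap\mathcal Y_c=\{0\}$, $H^0(P^\bullet)\in\mathcal X_c$ and $H^{-1}(P^\bullet)\in\mathcal Y_c$. 3. $(\mathcal X_c,\mathcal Y_c)$ is a torsion theory for $\operatorname{mod}A$ and $H^{-1}(P^\bullet)\in\mathcal Y_c$. 4. $(\mathcal X_c,\mathcal Y_c)$ is a torsion theory for $\operatorname{mod}A$ and $\mathcal X_c$ is stable under $DA\otimes_A-$. 5. $(\mathcal X_c,\mathcal Y_c)$ is a torsion theory for $\operatorname{mod}A$ and $\mathcal Y_c$ is stable under $\operatorname{Hom}_A(DA,-)$. -/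

import Mathlib

open CategoryTheory CategoryTheory.Limits
open scoped TensorProduct

universe w u

noncomputable section

namespace TwoTerm

/-! ### Torsion theories -/

section Torsion

variable {C : Type*} [Category C]

/-- `𝒳 ∩ 𝒴 = {0}`: the zero objects are exactly the objects lying in both `𝒳` and `𝒴`. -/
def MeetInZero (X Y : ObjectProperty C) : Prop :=
  ∀ Z : C, (X Z ∧ Y Z) ↔ IsZero Z

/-- A pair of full subcategories of an abelian category `C` is a torsion theory. (Only the zero
morphisms of `C` enter the definition.) -/
structure IsTorsionTheory [HasZeroMorphisms C] (X Y : ObjectProperty C) : Prop where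
  meet : MeetInZero X Y
  quotients : X.IsClosedUnderQuotients
  subobjects : Y.IsClosedUnderSubobjects
  exists_exact : ∀ Z : C, ∃ (Z' Z'' : C) (f : Z' ⟶ Z) (g : Z ⟶ Z'') (h : f ≫ g = 0),
    (ShortComplex.mk f g h).ShortExact ∧ X Z' ∧ Y Z''

end Torsion

/-! ### Tilting complexes -/

/-- `add T`: the direct summands of finite direct sums of copies of `T`. -/
def addClosure {C : Type*} [Category C] [Preadditive C] [HasFiniteBiproducts C]
    [HasBinaryBiproducts C] (T : C) :
    ObjectProperty C :=
  fun X => ∃ (n : ℕ) (Y : C), Nonempty ((X ⊞ Y) ≅ (⨁ fun _ : Fin n => T))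

section Modules

variable (A : Type u) [Ring A]

/-- The homotopy category `K(Mod A)` of (cochain) complexes of left `A`-modules. -/
abbrev K : Type (u + 1) := HomotopyCategory (ModuleCat.{u} A) (ComplexShape.up ℤ)

/-- `K^b(proj A)`, as a full (isomorphism-closed) subcategory of `K(Mod A)`: the objects isomorphic
to bounded complexes of finitely generated projective modules. -/
def KbProj : ObjectProperty (K A) :=
  fun X => ∃ L : CochainComplex (ModuleCat.{u} A) ℤ,
    (∀ i, Module.Finite A (L.X i) ∧ Module.Projective A (L.X i)) ∧
    (∃ a b : ℤ, ∀ i, (i < a ∨ b < i) → IsZero (L.X i)) ∧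
    Nonempty (X ≅ (HomotopyCategory.quotient _ _).obj L)

variable {A}

/-- Tilting complexes over `A` in the sense of Rickard. -/
structure IsTilting (T : K A) : Prop where
  /-- `T` is an object of `K^b(proj A)`. -/
  perfect : KbProj A T
  /-- `Hom(T, T[i]) = 0` for `i ≠ 0`. -/
  hom_shift_eq_zero : ∀ i : ℤ, i ≠ 0 → ∀ f : T ⟶ (shiftFunctor (K A) i).obj T, f = 0
  /-- `add T` generates `K^b(proj A)` as a triangulated category: every (strictly full)
  triangulated subcategory which contains `add T` contains `K^b(proj A)`. -/
  generates : ∀ S : ObjectProperty (K A), S.IsTriangulated → S.IsClosedUnderIsomorphisms →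
    addClosure T ≤ S → KbProj A ≤ S

/-! ### The two-term complex and its pair of subcategories -/

/-- The mapping cone of `d : P⁻¹ ⟶ P⁰`, i.e. the complex `P⁻¹ ⟶ P⁰` placed in degrees
`-1` and `0`. -/
def twoTerm {P₁ P₀ : ModuleCat.{u} A} (d : P₁ ⟶ P₀) : CochainComplex (ModuleCat.{u} A) ℤ :=
  CochainComplex.mappingCone ((CochainComplex.singleFunctor (ModuleCat.{u} A) 0).map d)

section

variable [HasDerivedCategory.{w} (ModuleCat.{u} A)] (P : CochainComplex (ModuleCat.{u} A) ℤ)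

/-- `𝒳(P)`: the modules `X` with `Hom_{D(Mod A)}(P, X[1]) = 0`. -/
def classX : ObjectProperty (ModuleCat.{u} A) :=
  fun X => ∀ f : DerivedCategory.Q.obj P ⟶
    (shiftFunctor (DerivedCategory (ModuleCat.{u} A)) (1 : ℤ)).obj
      ((DerivedCategory.singleFunctor (ModuleCat.{u} A) 0).obj X), f = 0

/-- `𝒴(P)`: the modules `X` with `Hom_{D(Mod A)}(P, X) = 0`. -/
def classY : ObjectProperty (ModuleCat.{u} A) :=
  fun X => ∀ f : DerivedCategory.Q.obj P ⟶
    (DerivedCategory.singleFunctor (ModuleCat.{u} A) 0).obj X, f = 0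

/-- `𝒳_c(P) = 𝒳(P) ∩ mod A`. -/
def classXc : ObjectProperty (ModuleCat.{u} A) := classX P ⊓ ModuleCat.isFG A

/-- `𝒴_c(P) = 𝒴(P) ∩ mod A`. -/
def classYc : ObjectProperty (ModuleCat.{u} A) := classY P ⊓ ModuleCat.isFG A

end

/-- `(X, Y)` is a torsion theory for `mod A`, the category of finitely generated modules. -/
def IsTorsionTheoryFG (X Y : ObjectProperty (ModuleCat.{u} A)) : Prop :=
  IsTorsionTheory (C := FGModuleCat.{u} A)
    (X.inverseImage (ModuleCat.isFG A).ι) (Y.inverseImage (ModuleCat.isFG A).ι)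

/-! ### Tensor product and `Hom` with a bimodule -/

section Bimodule

variable (M : Type u) [AddCommGroup M] [Module A M] [Module Aᵐᵒᵖ M] [SMulCommClass A Aᵐᵒᵖ M]

/-- The relations `(m a) ⊗ x - m ⊗ (a x)` in `M ⊗_ℤ X`. The set of these is stable under the left
action of `A` on `M ⊗_ℤ X`, so that their `A`-span is the additive subgroup they generate. -/
def balancedRelations (X : Type u) [AddCommGroup X] [Module A X] : Submodule A (M ⊗[ℤ] X) :=
  Submodule.span A {t | ∃ (m : M) (a : A) (x : X),
    t = (MulOpposite.op a • m) ⊗ₜ[ℤ] x - m ⊗ₜ[ℤ] (a • x)}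

/-- The left `A`-module `M ⊗_A X`, for an `A`-`A`-bimodule `M` and a left `A`-module `X`. -/
def bimoduleTensor (X : ModuleCat.{u} A) : ModuleCat.{u} A :=
  ModuleCat.of A ((M ⊗[ℤ] X) ⧸ balancedRelations (A := A) M X)

/-- The abelian group `Hom_A(M, Y)`, for an `A`-`A`-bimodule `M` and a left `A`-module `Y`. -/
def BimoduleHom (A : Type u) [Ring A] (M : Type u) [AddCommGroup M] [Module A M]
    (Y : Type u) [AddCommGroup Y] [Module A Y] : Type u := M →ₗ[A] Y

instance (Y : Type u) [AddCommGroup Y] [Module A Y] : AddCommGroup (BimoduleHom A M Y) :=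
  inferInstanceAs (AddCommGroup (M →ₗ[A] Y))

/-- The linear map underlying an element of `Hom_A(M, Y)`. -/
def BimoduleHom.lin {Y : Type u} [AddCommGroup Y] [Module A Y] (g : BimoduleHom A M Y) :
    M →ₗ[A] Y := g

/-- The left action `(a g)(m) = g(m a)` on `Hom_A(M, Y)`. -/
instance (Y : Type u) [AddCommGroup Y] [Module A Y] : Module A (BimoduleHom A M Y) where
  smul a g :=
    { toFun := fun m => g.lin M (MulOpposite.op a • m)
      map_add' := fun m n => by rw [smul_add, map_add]
      map_smul' := fun b m => by
        rw [← smul_comm b (MulOpposite.op a) m, map_smul, RingHom.id_apply] }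
  one_smul g := LinearMap.ext fun m => by
    change g.lin M (MulOpposite.op (1 : A) • m) = g.lin M m
    rw [MulOpposite.op_one, one_smul]
  mul_smul a b g := LinearMap.ext fun m => by
    change g.lin M (MulOpposite.op (a * b) • m) =
      g.lin M (MulOpposite.op b • MulOpposite.op a • m)
    rw [MulOpposite.op_mul, mul_smul]
  smul_zero _ := rfl
  smul_add _ _ _ := rfl
  add_smul a b g := LinearMap.ext fun m => by
    change g.lin M (MulOpposite.op (a + b) • m) =
      g.lin M (MulOpposite.op a • m) + g.lin M (MulOpposite.op b • m)
    rw [MulOpposite.op_add, add_smul, map_add]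
  zero_smul g := LinearMap.ext fun m => by
    change g.lin M (MulOpposite.op (0 : A) • m) = 0
    rw [MulOpposite.op_zero, zero_smul, map_zero]

/-- The left `A`-module `Hom_A(M, Y)`, for an `A`-`A`-bimodule `M` and a left `A`-module `Y`. -/
def bimoduleHom (Y : ModuleCat.{u} A) : ModuleCat.{u} A :=
  ModuleCat.of A (BimoduleHom A M Y)

end Bimodule

end Modules

/-! ### The bimodule `DA` -/

section Dual

variable (R : Type u) [CommRing R]

/-- `j : M → E` is an injective envelope: `E` is injective, and `j` is an essential
monomorphism. -/
structure IsInjectiveEnvelope {M E : Type u} [AddCommGroup M] [Module R M]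
    [AddCommGroup E] [Module R E] (j : M →ₗ[R] E) : Prop where
  injective_module : Module.Injective R E
  injective : Function.Injective j
  essential : ∀ N : Submodule R E, N ⊓ LinearMap.range j = ⊥ → N = ⊥

variable (A : Type u) [Ring A] [Algebra R A] (I : Type u) [AddCommGroup I] [Module R I]

/-- `DA = Hom_R(A, I)`. -/
def DualModule : Type u := A →ₗ[R] I

instance : AddCommGroup (DualModule R A I) := inferInstanceAs (AddCommGroup (A →ₗ[R] I))

variable {R A I} in
/-- The linear map underlying an element of `DA`. -/
def DualModule.lin (f : DualModule R A I) : A →ₗ[R] I := f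

/-- The left action `(a f)(x) = f(x a)` on `DA`. -/
instance : Module A (DualModule R A I) where
  smul a f := f.lin.comp (LinearMap.mulRight R a)
  one_smul f := LinearMap.ext fun x => congrArg f.lin (mul_one x)
  mul_smul a b f := LinearMap.ext fun x => congrArg f.lin (mul_assoc x a b).symm
  smul_zero _ := rfl
  smul_add _ _ _ := rfl
  add_smul a b f := LinearMap.ext fun x =>
    (congrArg f.lin (mul_add x a b)).trans (f.lin.map_add _ _)
  zero_smul f := LinearMap.ext fun x => (congrArg f.lin (mul_zero x)).trans f.lin.map_zero

/-- The right action `(f a)(x) = f(a x)` on `DA`. -/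
instance : Module Aᵐᵒᵖ (DualModule R A I) where
  smul a f := f.lin.comp (LinearMap.mulLeft R a.unop)
  one_smul f := LinearMap.ext fun x => congrArg f.lin (one_mul x)
  mul_smul a b f := LinearMap.ext fun x => congrArg f.lin (mul_assoc b.unop a.unop x)
  smul_zero _ := rfl
  smul_add _ _ _ := rfl
  add_smul a b f := LinearMap.ext fun x =>
    (congrArg f.lin (add_mul a.unop b.unop x)).trans (f.lin.map_add _ _)
  zero_smul f := LinearMap.ext fun x => (congrArg f.lin (zero_mul x)).trans f.lin.map_zero

instance : SMulCommClass A Aᵐᵒᵖ (DualModule R A I) where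
  smul_comm a b f := LinearMap.ext fun x => congrArg f.lin (mul_assoc b.unop x a).symm

end Dual

end TwoTerm

end

/-! Write T for the cone of d. For Q projective, placed in degree i, Hom(Q, X) = Hom_A(Q, Hⁱ X) in
the homotopy category (`homologyEval_injective`, `homologyEval_surjective`). With the triangle P₁ →
P₀ → T, the vanishing of Hom(T, X[n]) becomes a statement about d alone (`forall_cone_eq_zero_iff`):
maps P₁ → Hⁿ⁻¹X extend along d, and maps P₀ → HⁿX are detected along d. As T is K-projective, 𝒳_c
and 𝒴_c are the finitely generated modules with these two properties (`extendsFG`, `detectedFG`).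
Moreover H⁰T = coker d, H⁻¹T = ker d, and T has no self-extensions exactly when coker d extends and
ker d detects.

1 ⇔ 2: a module M in both classes has no maps from T to any of its shifts, hence none from A if T
generates, so M = 0. Conversely, a Bongartz-type completion puts every finitely generated projective
Q into the triangulated subcategory generated by T (`prop_of_addClosure_le`): the obstruction is an
object G with Hom(T, G) = Hom(T, G[1]) = 0, and then H⁰G lies in both classes, so Hom(Q, G) = 0.
Bounded complexes follow by stripping off terms.

2 ⇔ 3: if coker d is in 𝒳_c, its trace in Z is the torsion submodule of Z. Conversely, coker d has
no nonzero maps to 𝒴_c, so it is torsion.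

3 ⇔ 4: for Q finitely generated projective, Hom_A(Q, DA ⊗ X) is dual to Hom_A(X, Q) (`exists_trace`,
`exists_linearMap_of_functional`). So DA ⊗ X extends along d if and only if Hom_A(X, P₁) → Hom_A(X,
P₀) is injective, that is, Hom_A(X, ker d) = 0.

4 ⇔ 5: tensor-hom adjunction, as each class of a torsion theory is the orthogonal of the other. -/

noncomputable section

namespace TwoTerm

open CategoryTheory.Pretriangulated

/-! ### Extension and detection along a linear map -/

section Extension

variable {A : Type*} [Ring A] {P₁ P₀ : Type*} [AddCommGroup P₁] [Module A P₁]
  [AddCommGroup P₀] [Module A P₀] (d : P₁ →ₗ[A] P₀)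

/-- Every linear map `P₁ → M` extends along `d : P₁ → P₀`. -/
def ExtendsAlong (M : Type*) [AddCommGroup M] [Module A M] : Prop :=
  ∀ f : P₁ →ₗ[A] M, ∃ g : P₀ →ₗ[A] M, g ∘ₗ d = f

/-- A linear map `P₀ → M` vanishes as soon as its composition with `d : P₁ → P₀` does. -/
def DetectedAlong (M : Type*) [AddCommGroup M] [Module A M] : Prop :=
  ∀ g : P₀ →ₗ[A] M, g ∘ₗ d = 0 → g = 0

variable {M N : Type*} [AddCommGroup M] [Module A M] [AddCommGroup N] [Module A N]
variable {d}

lemma ExtendsAlong.of_surjective [Module.Projective A P₁] (h : ExtendsAlong d M)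
    (p : M →ₗ[A] N) (hp : Function.Surjective p) : ExtendsAlong d N := by
  intro f
  obtain ⟨f', rfl⟩ := Module.projective_lifting_property p f hp
  obtain ⟨g, rfl⟩ := h f'
  exact ⟨p ∘ₗ g, rfl⟩

lemma DetectedAlong.of_injective (h : DetectedAlong d N)
    (i : M →ₗ[A] N) (hi : Function.Injective i) : DetectedAlong d M := by
  intro g hg
  have : i ∘ₗ g = 0 := h _ (by rw [LinearMap.comp_assoc, hg, LinearMap.comp_zero])
  ext x
  exact hi (by simpa using LinearMap.congr_fun this x)

lemma ExtendsAlong.congr (e : M ≃ₗ[A] N) : ExtendsAlong d M ↔ ExtendsAlong d N := by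
  constructor
  · intro h f
    obtain ⟨g, hg⟩ := h (e.symm.toLinearMap ∘ₗ f)
    exact ⟨e.toLinearMap ∘ₗ g, by rw [LinearMap.comp_assoc, hg]; ext; simp⟩
  · intro h f
    obtain ⟨g, hg⟩ := h (e.toLinearMap ∘ₗ f)
    exact ⟨e.symm.toLinearMap ∘ₗ g, by rw [LinearMap.comp_assoc, hg]; ext; simp⟩

lemma DetectedAlong.congr (e : M ≃ₗ[A] N) : DetectedAlong d M ↔ DetectedAlong d N :=
  ⟨fun h => h.of_injective e.symm.toLinearMap e.symm.injective,
    fun h => h.of_injective e.toLinearMap e.injective⟩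

lemma ExtendsAlong.of_subsingleton [Subsingleton M] : ExtendsAlong d M :=
  fun _ => ⟨0, LinearMap.ext fun _ => Subsingleton.elim _ _⟩

lemma DetectedAlong.of_subsingleton [Subsingleton M] : DetectedAlong d M :=
  fun _ _ => LinearMap.ext fun _ => Subsingleton.elim _ _

lemma ExtendsAlong.prod (hM : ExtendsAlong d M) (hN : ExtendsAlong d N) :
    ExtendsAlong d (M × N) := by
  intro f
  obtain ⟨g, hg⟩ := hM (LinearMap.fst A M N ∘ₗ f)
  obtain ⟨g', hg'⟩ := hN (LinearMap.snd A M N ∘ₗ f)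
  exact ⟨g.prod g', LinearMap.ext fun x => Prod.ext (LinearMap.congr_fun hg x)
    (LinearMap.congr_fun hg' x)⟩

/-- The sum is a quotient of S × T. -/
lemma ExtendsAlong.sup [Module.Projective A P₁] {S T : Submodule A M}
    (hS : ExtendsAlong d S) (hT : ExtendsAlong d T) : ExtendsAlong d (S ⊔ T : Submodule A M) := by
  refine (hS.prod hT).of_surjective
    ((Submodule.inclusion le_sup_left).coprod (Submodule.inclusion le_sup_right)) ?_
  rintro ⟨x, hx⟩
  obtain ⟨y, hy, z, hz, rfl⟩ := Submodule.mem_sup.1 hx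
  exact ⟨(⟨y, hy⟩, ⟨z, hz⟩), Subtype.ext rfl⟩

lemma ExtendsAlong.finset_sup [Module.Projective A P₁] {ι : Type*} (s : Finset ι)
    (S : ι → Submodule A M) (h : ∀ i, ExtendsAlong d (S i)) :
    ExtendsAlong d (s.sup S : Submodule A M) := by
  classical
  induction s using Finset.induction_on with
  | empty =>
    rw [Finset.sup_empty]
    exact ExtendsAlong.of_subsingleton
  | insert i s _ ih =>
    rw [Finset.sup_insert]
    exact (h i).sup ih

variable (d M) in
/-- The sum of the images of the linear maps from the cokernel of `d` to `M`. -/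
def cokernelTrace : Submodule A M :=
  ⨆ g : {g : P₀ →ₗ[A] M // g ∘ₗ d = 0}, LinearMap.range g.1

/-- The trace is a finite sum of images of coker d because M is noetherian, and the class of coker d
is closed under quotients and finite sums. -/
lemma extendsAlong_cokernelTrace [Module.Projective A P₁] [IsNoetherian A M]
    (h : ExtendsAlong d (P₀ ⧸ LinearMap.range d)) : ExtendsAlong d (cokernelTrace d M) := by
  -- A finitely generated submodule is a compact element of the lattice, so finitely many images
  -- suffice.
  have hc : IsCompactElement (cokernelTrace d M) :=
    (Submodule.fg_iff_compact _).1 (IsNoetherian.noetherian _)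
  obtain ⟨s, hs⟩ := CompleteLattice.IsCompactElement.exists_finset_of_le_iSup _ hc
    (fun g : {g : P₀ →ₗ[A] M // g ∘ₗ d = 0} => LinearMap.range g.1) le_rfl
  have heq : cokernelTrace d M = s.sup (fun g => LinearMap.range g.1) := by
    refine le_antisymm (hs.trans_eq (Finset.sup_eq_iSup _ _).symm) ?_
    exact Finset.sup_le fun g _ => le_iSup (fun g : {g : P₀ →ₗ[A] M // g ∘ₗ d = 0} =>
      LinearMap.range g.1) g
  rw [heq]
  refine ExtendsAlong.finset_sup s _ fun g => ?_
  have hg : LinearMap.range d ≤ LinearMap.ker g.1.rangeRestrict := by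
    rintro _ ⟨x, rfl⟩
    exact Subtype.ext (LinearMap.congr_fun g.2 x)
  refine h.of_surjective ((LinearMap.range d).liftQ g.1.rangeRestrict hg) ?_
  rw [← LinearMap.range_eq_top, Submodule.range_liftQ, LinearMap.range_eq_top]
  exact g.1.surjective_rangeRestrict

/-- Lift a map that kills the image of d to g' : P₀ → M. Then g' ∘ d lands in the trace and extends
to some k with values there; g' - k factors through coker d, so it also lands in the trace, and
hence so does g'. -/
lemma detectedAlong_quotient_cokernelTrace [Module.Projective A P₀]
    (h : ExtendsAlong d (cokernelTrace d M)) : DetectedAlong d (M ⧸ cokernelTrace d M) := by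
  intro g hg
  obtain ⟨g', rfl⟩ := Module.projective_lifting_property (cokernelTrace d M).mkQ g
    (Submodule.mkQ_surjective _)
  have hmem : ∀ x, g' (d x) ∈ cokernelTrace d M := fun x => by
    simpa using LinearMap.congr_fun hg x
  obtain ⟨k, hk⟩ := h (LinearMap.codRestrict _ (g' ∘ₗ d) hmem)
  have hk' : ∀ x, (k (d x) : M) = g' (d x) := fun x =>
    congrArg Subtype.val (LinearMap.congr_fun hk x)
  have hz : (g' - (cokernelTrace d M).subtype ∘ₗ k) ∘ₗ d = 0 := by
    ext x
    simp [hk']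
  ext y
  have hy : (g' - (cokernelTrace d M).subtype ∘ₗ k) y ∈ cokernelTrace d M :=
    Submodule.mem_iSup_of_mem (⟨_, hz⟩ : {g : P₀ →ₗ[A] M // g ∘ₗ d = 0}) ⟨y, rfl⟩
  have : g' y ∈ cokernelTrace d M := by
    have := Submodule.add_mem _ hy (k y).2
    simpa using this
  simpa using this

/-- If only the zero finitely generated module is both extended to and detected along `d`, then
there are no nonzero maps from the modules of the first kind to those of the second kind. -/
lemma linearMap_eq_zero_of_meet [IsNoetherianRing A] [Module.Projective A P₁]
    (hmeet : ∀ S : Submodule A N, ExtendsAlong d S → DetectedAlong d S → S = ⊥)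
    (hM : ExtendsAlong d M) (hN : DetectedAlong d N) (f : M →ₗ[A] N) : f = 0 := by
  rw [← LinearMap.range_eq_bot]
  exact hmeet _ (hM.of_surjective _ f.surjective_rangeRestrict)
    (hN.of_injective _ (LinearMap.range f).injective_subtype)

end Extension

/-! ### Torsion theories for finitely generated modules -/

section TorsionTheory

variable {A : Type u} [Ring A]

lemma isZero_fgModuleCat_iff [IsNoetherianRing A] (Z : FGModuleCat.{u} A) :
    IsZero Z ↔ IsZero Z.obj := by
  constructor
  · intro h
    exact (ModuleCat.isFG A).ι.map_isZero h
  · intro h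
    rw [IsZero.iff_id_eq_zero]
    apply (ModuleCat.isFG A).ι.map_injective
    exact h.eq_of_src _ _

lemma meetInZero_inverseImage_iff [IsNoetherianRing A] {X Y : ObjectProperty (ModuleCat.{u} A)} :
    MeetInZero (C := FGModuleCat.{u} A)
      ((X ⊓ ModuleCat.isFG A).inverseImage (ModuleCat.isFG A).ι)
      ((Y ⊓ ModuleCat.isFG A).inverseImage (ModuleCat.isFG A).ι) ↔
    MeetInZero (X ⊓ ModuleCat.isFG A) (Y ⊓ ModuleCat.isFG A) := by
  constructor
  · intro h Z
    constructor
    · intro hZ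
      exact (isZero_fgModuleCat_iff ⟨Z, hZ.1.2⟩).1 ((h ⟨Z, hZ.1.2⟩).1 hZ)
    · intro hZ
      have : ModuleCat.isFG A Z := by
        have := ModuleCat.subsingleton_of_isZero hZ
        rw [ModuleCat.isFG_iff]
        infer_instance
      exact (h ⟨Z, this⟩).2 ((isZero_fgModuleCat_iff ⟨Z, this⟩).2 hZ)
  · intro h Z
    rw [isZero_fgModuleCat_iff]
    exact h Z.obj

/-- The short exact sequence of finitely generated modules given by a submodule. -/
lemma exists_shortExact_of_submodule [IsNoetherianRing A] (Z : FGModuleCat.{u} A)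
    (S : Submodule A Z.obj) :
    ∃ (Z' Z'' : FGModuleCat.{u} A) (f : Z' ⟶ Z) (g : Z ⟶ Z'') (h : f ≫ g = 0),
      (ShortComplex.mk f g h).ShortExact ∧ Z'.obj = ModuleCat.of A S ∧
        Z''.obj = ModuleCat.of A (Z.obj ⧸ S) := by
  have : Module.Finite A Z.obj := Z.property
  have h₁ : ModuleCat.isFG A (ModuleCat.of A S) := by
    rw [ModuleCat.isFG_iff]
    infer_instance
  have h₂ : ModuleCat.isFG A (ModuleCat.of A (Z.obj ⧸ S)) := by
    rw [ModuleCat.isFG_iff]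
    infer_instance
  let f : (⟨_, h₁⟩ : FGModuleCat.{u} A) ⟶ Z := ObjectProperty.homMk (ModuleCat.ofHom S.subtype)
  let g : Z ⟶ (⟨_, h₂⟩ : FGModuleCat.{u} A) := ObjectProperty.homMk (ModuleCat.ofHom S.mkQ)
  have h : f ≫ g = 0 := by
    apply (ModuleCat.isFG A).ι.map_injective
    ext x
    exact (Submodule.Quotient.mk_eq_zero S).2 x.2
  refine ⟨_, _, f, g, h, ?_, rfl, rfl⟩
  have hf : Mono ((forget₂ (FGModuleCat.{u} A) (ModuleCat.{u} A)).map f) :=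
    (ModuleCat.mono_iff_injective _).2 S.injective_subtype
  have hg : Epi ((forget₂ (FGModuleCat.{u} A) (ModuleCat.{u} A)).map g) :=
    (ModuleCat.epi_iff_surjective _).2 S.mkQ_surjective
  have : Mono f := (forget₂ (FGModuleCat.{u} A) (ModuleCat.{u} A)).mono_of_mono_map hf
  have : Epi g := (forget₂ (FGModuleCat.{u} A) (ModuleCat.{u} A)).epi_of_epi_map hg
  refine ⟨?_⟩
  rw [← ShortComplex.exact_map_iff_of_faithful _ (forget₂ (FGModuleCat.{u} A) (ModuleCat.{u} A)),
    ShortComplex.moduleCat_exact_iff]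
  intro x hx
  exact ⟨⟨x, (Submodule.Quotient.mk_eq_zero S).1 hx⟩, rfl⟩

variable {P₁ P₀ : Type u} [AddCommGroup P₁] [Module A P₁] [AddCommGroup P₀] [Module A P₀]

/-- The finitely generated modules `M` such that all linear maps `P₁ → M` extend along `d`. -/
def extendsFG (d : P₁ →ₗ[A] P₀) : ObjectProperty (ModuleCat.{u} A) :=
  (fun M => ExtendsAlong d M) ⊓ ModuleCat.isFG A

/-- The finitely generated modules `M` such that linear maps `P₀ → M` are detected along `d`. -/
def detectedFG (d : P₁ →ₗ[A] P₀) : ObjectProperty (ModuleCat.{u} A) :=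
  (fun M => DetectedAlong d M) ⊓ ModuleCat.isFG A

lemma extendsFG_iff (d : P₁ →ₗ[A] P₀) (M : ModuleCat.{u} A) :
    extendsFG d M ↔ ExtendsAlong d M ∧ Module.Finite A M := Iff.rfl

lemma detectedFG_iff (d : P₁ →ₗ[A] P₀) (M : ModuleCat.{u} A) :
    detectedFG d M ↔ DetectedAlong d M ∧ Module.Finite A M := Iff.rfl

variable {d : P₁ →ₗ[A] P₀}

variable {Z : Type u} [AddCommGroup Z] [Module A Z] [Module.Finite A Z]

/-- The torsion class is the whole left orthogonal of the torsionfree class: the map onto the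
torsionfree part of Z is zero, so the torsion part surjects onto Z. -/
lemma IsTorsionTheoryFG.extendsAlong (h : IsTorsionTheoryFG (extendsFG d) (detectedFG d))
    (hZ : ∀ (N : Type u) [AddCommGroup N] [Module A N] [Module.Finite A N],
      DetectedAlong d N → ∀ f : Z →ₗ[A] N, f = 0) : ExtendsAlong d Z := by
  have hfg : ModuleCat.isFG A (ModuleCat.of A Z) := by
    rw [ModuleCat.isFG_iff]
    infer_instance
  obtain ⟨Z', Z'', f, g, hfg', hex, h₁, h₂⟩ := h.exists_exact ⟨_, hfg⟩
  have : Module.Finite A Z''.obj := Z''.property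
  have hg : g = 0 := by
    apply (ModuleCat.isFG A).ι.map_injective
    exact ModuleCat.hom_ext (hZ Z''.obj h₂.1 g.hom.hom)
  have : Epi f := hex.exact.epi_f hg
  exact (h.quotients.prop_of_epi f h₁).1

/-- Dually, the inclusion of the torsion part is zero, so Z embeds into its torsionfree quotient. -/
lemma IsTorsionTheoryFG.detectedAlong (h : IsTorsionTheoryFG (extendsFG d) (detectedFG d))
    (hZ : ∀ (M : Type u) [AddCommGroup M] [Module A M] [Module.Finite A M],
      ExtendsAlong d M → ∀ f : M →ₗ[A] Z, f = 0) : DetectedAlong d Z := by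
  have hfg : ModuleCat.isFG A (ModuleCat.of A Z) := by
    rw [ModuleCat.isFG_iff]
    infer_instance
  obtain ⟨Z', Z'', f, g, hfg', hex, h₁, h₂⟩ := h.exists_exact ⟨_, hfg⟩
  have : Module.Finite A Z'.obj := Z'.property
  have hf : f = 0 := by
    apply (ModuleCat.isFG A).ι.map_injective
    exact ModuleCat.hom_ext (hZ Z'.obj h₁.1 f.hom.hom)
  have : Mono g := hex.exact.mono_g hf
  exact (h.subobjects.prop_of_mono g h₂).1

variable [IsNoetherianRing A]

lemma linearMap_eq_zero_of_meetInZero [Module.Projective A P₁]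
    (h : MeetInZero (extendsFG d) (detectedFG d))
    {M N : Type u} [AddCommGroup M] [Module A M] [AddCommGroup N] [Module A N]
    [Module.Finite A N] (hM : ExtendsAlong d M) (hN : DetectedAlong d N) (f : M →ₗ[A] N) :
    f = 0 := by
  refine linearMap_eq_zero_of_meet (fun S h₁ h₂ => ?_) hM hN f
  have hfin : Module.Finite A S := inferInstance
  have := ModuleCat.subsingleton_of_isZero
    ((h (ModuleCat.of A S)).1 ⟨(extendsFG_iff d _).2 ⟨h₁, hfin⟩,
      (detectedFG_iff d _).2 ⟨h₂, hfin⟩⟩)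
  exact Submodule.eq_bot_of_subsingleton

lemma isTorsionTheoryFG_of_extendsAlong [Module.Projective A P₁] [Module.Projective A P₀]
    (h : MeetInZero (extendsFG d) (detectedFG d))
    (hd : ExtendsAlong d (P₀ ⧸ LinearMap.range d)) :
    IsTorsionTheoryFG (extendsFG d) (detectedFG d) where
  meet := meetInZero_inverseImage_iff.2 h
  quotients := ⟨fun {X Y} f hf hX => by
    have : Epi ((forget₂ (FGModuleCat.{u} A) (ModuleCat.{u} A)).map f) := inferInstance
    exact ⟨hX.1.of_surjective f.hom.hom ((ModuleCat.epi_iff_surjective _).1 this), Y.property⟩⟩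
  subobjects := ⟨fun {X Y} f hf hY => by
    have : Mono ((forget₂ (FGModuleCat.{u} A) (ModuleCat.{u} A)).map f) := inferInstance
    exact ⟨hY.1.of_injective f.hom.hom ((ModuleCat.mono_iff_injective _).1 this), X.property⟩⟩
  exists_exact Z := by
    have : Module.Finite A Z.obj := Z.property
    obtain ⟨Z', Z'', f, g, hfg, hex, h₁, h₂⟩ :=
      exists_shortExact_of_submodule Z (cokernelTrace d Z.obj)
    have ht : ExtendsAlong d (cokernelTrace d Z.obj) := extendsAlong_cokernelTrace hd
    refine ⟨Z', Z'', f, g, hfg, hex, ⟨?_, Z'.property⟩, ⟨?_, Z''.property⟩⟩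
    · change ExtendsAlong d Z'.obj
      rw [h₁]
      exact ht
    · change DetectedAlong d Z''.obj
      rw [h₂]
      exact detectedAlong_quotient_cokernelTrace ht

lemma IsTorsionTheoryFG.meetInZero (h : IsTorsionTheoryFG (extendsFG d) (detectedFG d)) :
    MeetInZero (extendsFG d) (detectedFG d) :=
  meetInZero_inverseImage_iff.1 h.meet

/-- A map from coker d to a detected module vanishes, since its composition with P₀ → coker d kills
d; so coker d is torsion in any such torsion theory. Conversely the trace of coker d supplies the
torsion submodules. -/
lemma isTorsionTheoryFG_iff [Module.Projective A P₁] [Module.Finite A P₀] [Module.Projective A P₀] :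
    IsTorsionTheoryFG (extendsFG d) (detectedFG d) ↔
      MeetInZero (extendsFG d) (detectedFG d) ∧ ExtendsAlong d (P₀ ⧸ LinearMap.range d) := by
  refine ⟨fun h => ⟨h.meetInZero, h.extendsAlong fun N _ _ _ hN f => ?_⟩,
    fun h => isTorsionTheoryFG_of_extendsAlong h.1 h.2⟩
  have := hN (f ∘ₗ (LinearMap.range d).mkQ) (by
    rw [LinearMap.comp_assoc, LinearMap.range_mkQ_comp, LinearMap.comp_zero])
  rw [← LinearMap.cancel_right (LinearMap.range d).mkQ_surjective, this, LinearMap.zero_comp]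

end TorsionTheory

/-! ### The injective envelope of R / rad R: finiteness and cogeneration -/

section Envelope

variable {R : Type u} [CommRing R] [IsArtinianRing R] {I : Type u} [AddCommGroup I] [Module R I]
  {j : (R ⧸ Ring.jacobson R) →ₗ[R] I}

/-- The elements killed by the radical form a module over the semisimple ring R / rad R, so the
image of j has a complement there, and this is zero because j is essential. -/
lemma IsInjectiveEnvelope.torsionBySet_le_range (hj : IsInjectiveEnvelope R j) :
    Submodule.torsionBySet R I (Ring.jacobson R) ≤ LinearMap.range j := by
  set T := Submodule.torsionBySet R I (Ring.jacobson R) with hT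
  have hjT : LinearMap.range j ≤ T := by
    rintro _ ⟨x, rfl⟩
    rw [hT, Submodule.mem_torsionBySet_iff]
    rintro ⟨r, hr⟩
    obtain ⟨x, rfl⟩ := Ideal.Quotient.mk_surjective x
    rw [← map_smul, Algebra.smul_def, Ideal.Quotient.algebraMap_eq,
      Ideal.Quotient.eq_zero_iff_mem.2 hr, zero_mul, map_zero]
  have : IsSemisimpleModule R T := by
    -- The identity, semilinear over R → R / rad R, transports semisimplicity back to R.
    let l : T →ₛₗ[Ideal.Quotient.mk (Ring.jacobson R)] T :=
      { toFun := id, map_add' := fun _ _ => rfl, map_smul' := fun _ _ => rfl }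
    rw [LinearMap.isSemisimpleModule_iff_of_bijective l Function.bijective_id]
    infer_instance
  obtain ⟨C, hC⟩ := exists_isCompl ((LinearMap.range j).comap T.subtype)
  have hC0 : C.map T.subtype = ⊥ := by
    refine hj.essential _ (eq_bot_iff.2 ?_)
    rintro _ ⟨⟨x, hx, rfl⟩, hx'⟩
    have : x ∈ (LinearMap.range j).comap T.subtype ⊓ C := ⟨hx', hx⟩
    rw [hC.inf_eq_bot] at this
    simpa using this
  replace hC0 : C = ⊥ := eq_bot_iff.2 fun x hx => by
    have hx' : (x : I) ∈ C.map T.subtype := ⟨x, hx, rfl⟩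
    rw [hC0] at hx'
    exact Subtype.ext hx'
  have htop := hC.sup_eq_top
  rw [hC0, sup_bot_eq] at htop
  intro x hx
  have : (⟨x, hx⟩ : T) ∈ (LinearMap.range j).comap T.subtype := htop ▸ trivial
  exact this

/-- Let T n be the part of I killed by the n-th power of the radical, and r₁, …, r_m generators of
the radical. Then x ↦ (rᵢ x) maps T (n + 1) to (T n)ᵐ with kernel T 1, and T 1 is noetherian as it
lies in the image of j. -/
lemma IsInjectiveEnvelope.isNoetherian_torsionBySet_pow (hj : IsInjectiveEnvelope R j) (n : ℕ) :
    IsNoetherian R (Submodule.torsionBySet R I ((Ring.jacobson R ^ n : Ideal R) : Set R)) := by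
  have h1 : IsNoetherian R (Submodule.torsionBySet R I (Ring.jacobson R)) :=
    isNoetherian_of_le hj.torsionBySet_le_range
  induction n with
  | zero =>
    have : Submodule.torsionBySet R I ((Ring.jacobson R ^ 0 : Ideal R) : Set R) = ⊥ := by
      rw [pow_zero, Ideal.one_eq_top, Submodule.top_coe, Submodule.torsionBySet_univ]
    rw [this]
    infer_instance
  | succ n ih =>
    obtain ⟨m, r, hr⟩ := Submodule.fg_iff_exists_fin_generating_family.1
      (IsNoetherian.noetherian (Ring.jacobson R))
    have hrJ : ∀ i, r i ∈ Ring.jacobson R := fun i => hr ▸ Submodule.subset_span ⟨i, rfl⟩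
    set T := fun n : ℕ => Submodule.torsionBySet R I ((Ring.jacobson R ^ n : Ideal R) : Set R)
    have hmem : ∀ (i : Fin m) (x : T (n + 1)), r i • (x : I) ∈ T n := by
      rintro i ⟨x, hx⟩
      rw [Submodule.mem_torsionBySet_iff] at hx ⊢
      rintro ⟨a, ha⟩
      have := hx ⟨a * r i, by rw [pow_succ]; exact Ideal.mul_mem_mul ha (hrJ i)⟩
      rwa [← mul_smul]
    have hmemJ : ∀ y : I, (∀ i, r i • y = 0) →
        y ∈ Submodule.torsionBySet R I (Ring.jacobson R) := by
      intro y hy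
      rw [← hr, ← Submodule.torsionBySet_eq_torsionBySet_span, Submodule.mem_torsionBySet_iff]
      rintro ⟨_, i, rfl⟩
      exact hy i
    let φ : T (n + 1) →ₗ[R] (Fin m → T n) := LinearMap.pi fun i =>
      LinearMap.codRestrict _ (r i • (T (n + 1)).subtype) (hmem i)
    have hT1 : Submodule.torsionBySet R I (Ring.jacobson R) ≤ T (n + 1) :=
      Submodule.torsionBySet_le_torsionBySet_of_subset
        (Ideal.pow_le_self (Nat.succ_ne_zero n))
    have : IsNoetherian R (Fin m → T n) := inferInstance
    refine isNoetherian_of_range_eq_ker (Submodule.inclusion hT1) φ ?_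
    ext x
    rw [Submodule.range_inclusion, Submodule.mem_comap, LinearMap.mem_ker]
    constructor
    · intro hx
      ext i
      rw [Submodule.subtype_apply, Submodule.mem_torsionBySet_iff] at hx
      exact hx ⟨r i, hrJ i⟩
    · intro hx
      have hx' : ∀ i, r i • (x : I) = 0 := fun i => congrArg Subtype.val (congrFun hx i)
      exact hmemJ _ hx'

/-- The injective envelope of `R / rad R` is a finitely generated module. -/
lemma IsInjectiveEnvelope.isNoetherian (hj : IsInjectiveEnvelope R j) : IsNoetherian R I := by
  -- The radical is nilpotent, so one of these torsion submodules is all of I.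
  obtain ⟨n, hn⟩ := IsSemiprimaryRing.isNilpotent (R := R)
  have := hj.isNoetherian_torsionBySet_pow n
  have htop : Submodule.torsionBySet R I ((Ring.jacobson R ^ n : Ideal R) : Set R) = ⊤ := by
    rw [hn, eq_top_iff]
    intro x _
    rw [Submodule.mem_torsionBySet_iff]
    rintro ⟨a, rfl⟩
    exact zero_smul _ _
  rw [htop] at this
  exact isNoetherian_of_linearEquiv Submodule.topEquiv

/-- The injective envelope of `R / rad R` is a cogenerator. -/
lemma IsInjectiveEnvelope.exists_apply_ne_zero (hj : IsInjectiveEnvelope R j) {M : Type u}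
    [AddCommGroup M] [Module R M] {x : M} (hx : x ≠ 0) : ∃ f : M →ₗ[R] I, f x ≠ 0 := by
  have := hj.injective_module
  set K := LinearMap.ker (LinearMap.toSpanSingleton R M x)
  have hK : K ≠ ⊤ := fun h => hx (by
    have : (1 : R) ∈ K := h ▸ trivial
    simpa [K] using this)
  obtain ⟨m, hm, hKm⟩ := Ideal.exists_le_maximal K hK
  have hJm : Ring.jacobson R ≤ m := by
    rw [Ring.jacobson_eq_sInf_isMaximal]
    exact sInf_le hm
  let p : (R ⧸ Ring.jacobson R) →ₗ[R] (R ⧸ m) := Submodule.factor hJm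
  have : IsSemisimpleModule R (R ⧸ Ring.jacobson R) := by
    let l : (R ⧸ Ring.jacobson R) →ₛₗ[Ideal.Quotient.mk (Ring.jacobson R)]
        (R ⧸ Ring.jacobson R) :=
      { toFun := id
        map_add' := fun _ _ => rfl
        map_smul' := fun a b => by rw [Algebra.smul_def]; rfl }
    rw [LinearMap.isSemisimpleModule_iff_of_bijective l Function.bijective_id]
    infer_instance
  -- By semisimplicity R / m embeds into R / rad R, hence into I. The map Rx ≅ R / K → R / m → I is
  -- nonzero at x and extends to M by injectivity of I.
  obtain ⟨s, hs⟩ := IsSemisimpleModule.lifting_property p (Submodule.factor_surjective hJm)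
    LinearMap.id
  have hsinj : Function.Injective s := fun a b hab => by
    simpa using (LinearMap.congr_fun hs a).symm.trans
      ((congrArg p hab).trans (LinearMap.congr_fun hs b))
  let g : (R ⧸ K) →ₗ[R] I := j ∘ₗ s ∘ₗ Submodule.factor hKm
  obtain ⟨f, hf⟩ := Module.Injective.out
    (K.liftQ (LinearMap.toSpanSingleton R M x) le_rfl)
    (LinearMap.ker_eq_bot.1 (Submodule.ker_liftQ_eq_bot' _ _ rfl)) g
  refine ⟨f, fun h0 => ?_⟩
  have h1 := hf (Submodule.Quotient.mk 1)
  rw [Submodule.liftQ_apply, LinearMap.toSpanSingleton_apply, one_smul, h0] at h1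
  have h2 : (Submodule.Quotient.mk 1 : R ⧸ m) = 0 := by
    apply hsinj
    apply hj.injective
    rw [map_zero, map_zero]
    exact h1.symm
  rw [Submodule.Quotient.mk_eq_zero] at h2
  exact hm.ne_top ((Ideal.eq_top_iff_one _).2 h2)

end Envelope

/-! ### The tensor product with a bimodule and its adjunction -/

section BimoduleTensor

variable {A : Type u} [Ring A] (M : Type u) [AddCommGroup M] [Module A M] [Module Aᵐᵒᵖ M]
  (X : Type u) [AddCommGroup X] [Module A X]

/-- The underlying type of `M ⊗_A X`. -/
abbrev BalancedTensor : Type u := (M ⊗[ℤ] X) ⧸ balancedRelations (A := A) M X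

variable {M X}

/-- The elementary tensor `m ⊗ x` in `M ⊗_A X`. -/
def balancedTmul (m : M) (x : X) : BalancedTensor (A := A) M X :=
  Submodule.Quotient.mk (m ⊗ₜ[ℤ] x)

lemma balancedTmul_add (m : M) (x y : X) :
    balancedTmul (A := A) m (x + y) = balancedTmul m x + balancedTmul m y := by
  rw [balancedTmul, TensorProduct.tmul_add]
  rfl

lemma add_balancedTmul (m n : M) (x : X) :
    balancedTmul (A := A) (m + n) x = balancedTmul m x + balancedTmul n x := by
  rw [balancedTmul, TensorProduct.add_tmul]
  rfl

lemma op_smul_balancedTmul (a : A) (m : M) (x : X) :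
    balancedTmul (A := A) (MulOpposite.op a • m) x = balancedTmul m (a • x) := by
  rw [← sub_eq_zero]
  refine (Submodule.Quotient.mk_eq_zero _).2 ?_
  exact Submodule.subset_span ⟨m, a, x, rfl⟩

/-- `m ↦ m ⊗ x` as a linear map. -/
def balancedTmulLeft (x : X) : M →ₗ[A] BalancedTensor (A := A) M X where
  toFun m := balancedTmul m x
  map_add' m n := add_balancedTmul m n x
  map_smul' _ _ := rfl

/-- `x ↦ m ⊗ x` as an additive map. -/
def balancedTmulRight (m : M) : X →+ BalancedTensor (A := A) M X :=
  AddMonoidHom.mk' (balancedTmul m) (balancedTmul_add m)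

lemma sum_balancedTmul {ι : Type*} (s : Finset ι) (f : ι → M) (x : X) :
    balancedTmul (A := A) (∑ i ∈ s, f i) x = ∑ i ∈ s, balancedTmul (f i) x :=
  map_sum (balancedTmulLeft x) f s

lemma balancedTmul_sum {ι : Type*} (s : Finset ι) (m : M) (x : ι → X) :
    balancedTmul (A := A) m (∑ i ∈ s, x i) = ∑ i ∈ s, balancedTmul m (x i) :=
  map_sum (balancedTmulRight m) x s

lemma balancedTensor_induction {p : BalancedTensor (A := A) M X → Prop}
    (tmul : ∀ m x, p (balancedTmul m x)) (add : ∀ s t, p s → p t → p (s + t))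
    (t : BalancedTensor (A := A) M X) : p t := by
  obtain ⟨t, rfl⟩ := Submodule.Quotient.mk_surjective _ t
  induction t with
  | zero =>
    have := tmul 0 0
    rwa [balancedTmul, TensorProduct.zero_tmul] at this
  | tmul m x => exact tmul m x
  | add s t hs ht => exact add _ _ hs ht

/-- The map from a power of `M` to `M ⊗_A X` given by finitely many elements of `X`. -/
def balancedSum {n : ℕ} (x : Fin n → X) : (Fin n → M) →ₗ[A] BalancedTensor (A := A) M X :=
  ∑ i, balancedTmulLeft (x i) ∘ₗ LinearMap.proj i

lemma balancedSum_apply {n : ℕ} (x : Fin n → X) (m : Fin n → M) :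
    balancedSum (A := A) x m = ∑ i, balancedTmul (m i) (x i) := by
  simp only [balancedSum, LinearMap.sum_apply]
  rfl

/-- Coefficients of an element of X in the generators move across the tensor sign through the right
action on M. -/
lemma balancedSum_surjective {n : ℕ} {x : Fin n → X}
    (hx : Submodule.span A (Set.range x) = ⊤) :
    Function.Surjective (balancedSum (A := A) (M := M) x) := by
  intro t
  induction t using balancedTensor_induction with
  | tmul m y =>
    obtain ⟨c, hc⟩ := (Submodule.mem_span_range_iff_exists_fun A).1
      (show y ∈ Submodule.span A (Set.range x) from hx ▸ trivial)
    refine ⟨fun i => MulOpposite.op (c i) • m, ?_⟩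
    rw [balancedSum_apply, ← hc, balancedTmul_sum]
    exact Finset.sum_congr rfl fun i _ => op_smul_balancedTmul _ _ _
  | add s t hs ht =>
    obtain ⟨m, rfl⟩ := hs
    obtain ⟨n, rfl⟩ := ht
    exact ⟨m + n, map_add _ _ _⟩

lemma finite_balancedTensor [Module.Finite A M] [Module.Finite A X] :
    Module.Finite A (BalancedTensor (A := A) M X) := by
  obtain ⟨n, x, hx⟩ := Module.Finite.exists_fin (R := A) (M := X)
  exact Module.Finite.of_surjective _ (balancedSum_surjective (M := M) hx)

variable {Y : Type u} [AddCommGroup Y] [Module A Y]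

variable (A) in
/-- The additive map on `M ⊗_ℤ X` induced by a biadditive map. -/
def intLift {Z : Type*} [AddCommGroup Z] (β : M →+ X →+ Z) : (M ⊗[ℤ] X) →+ Z :=
  TensorProduct.liftAddHom β fun r m x => by simp

lemma intLift_tmul {Z : Type*} [AddCommGroup Z] (β : M →+ X →+ Z) (m : M) (x : X) :
    intLift β (m ⊗ₜ[ℤ] x) = β m x := rfl

variable [SMulCommClass A Aᵐᵒᵖ M]

/-- The linear map `M ⊗_A X → Y` adjoint to a linear map `X → Hom_A(M, Y)`. -/
def balancedLift (ψ : X →ₗ[A] BimoduleHom A M Y) : BalancedTensor (A := A) M X →ₗ[A] Y :=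
  (balancedRelations (A := A) M X).liftQ
    { toFun := intLift (AddMonoidHom.mk'
        (fun m => AddMonoidHom.mk' (fun x => (ψ x).lin M m) fun x y => by
          rw [map_add]; rfl)
        fun m n => by ext x; exact map_add ((ψ x).lin M) m n)
      map_add' := map_add _
      map_smul' := fun a t => by
        induction t with
        | zero => simp
        | tmul m x =>
          rw [TensorProduct.smul_tmul', intLift_tmul, intLift_tmul]
          exact map_smul ((ψ x).lin M) a m
        | add s t hs ht => rw [smul_add, map_add, hs, ht, map_add, smul_add] } (by
    rw [balancedRelations, Submodule.span_le]
    rintro _ ⟨m, a, x, rfl⟩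
    rw [SetLike.mem_coe, LinearMap.mem_ker, map_sub, sub_eq_zero]
    change (ψ x).lin M (MulOpposite.op a • m) = (ψ (a • x)).lin M m
    rw [show ψ (a • x) = a • ψ x from map_smul ψ a x]
    rfl)

/-- The linear map `X → Hom_A(M, Y)` adjoint to a linear map `M ⊗_A X → Y`. -/
def balancedCurry (φ : BalancedTensor (A := A) M X →ₗ[A] Y) : X →ₗ[A] BimoduleHom A M Y where
  toFun x := φ ∘ₗ balancedTmulLeft x
  map_add' x y := LinearMap.ext fun m => by
    change φ (balancedTmul m (x + y)) = φ (balancedTmul m x) + φ (balancedTmul m y)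
    rw [balancedTmul_add, map_add]
  map_smul' a x := LinearMap.ext fun m =>
    congrArg φ (op_smul_balancedTmul a m x).symm

variable (M X Y) in
-- Orthogonality is all that is used of the tensor-hom adjunction.
lemma forall_balancedTensor_eq_zero_iff :
    (∀ φ : BalancedTensor (A := A) M X →ₗ[A] Y, φ = 0) ↔
      ∀ ψ : X →ₗ[A] BimoduleHom A M Y, ψ = 0 := by
  constructor
  · intro h ψ
    ext x
    refine LinearMap.ext fun m => ?_
    exact LinearMap.congr_fun (h (balancedLift ψ)) (balancedTmul m x)
  · intro h φ
    refine LinearMap.ext fun t => ?_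
    induction t using balancedTensor_induction with
    | tmul m x =>
      have := congrArg (fun g : BimoduleHom A M Y => g.lin M m)
        (LinearMap.congr_fun (h (balancedCurry φ)) x)
      exact this
    | add s t hs ht => rw [map_add, hs, ht, map_add]

end BimoduleTensor

/-! ### Stability under tensor product versus stability under Hom -/

section Adjunction

variable {A : Type u} [Ring A] [IsNoetherianRing A] {P₁ P₀ : Type u} [AddCommGroup P₁]
  [Module A P₁] [AddCommGroup P₀] [Module A P₀] [Module.Projective A P₁] {d : P₁ →ₗ[A] P₀}
  (M : Type u) [AddCommGroup M] [Module A M] [Module Aᵐᵒᵖ M] [SMulCommClass A Aᵐᵒᵖ M]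

/-- For a torsion theory, stability of the torsion class under `M ⊗_A -` is equivalent to
stability of the torsionfree class under `Hom_A(M, -)`. -/
lemma IsTorsionTheoryFG.tensor_stable_iff
    (h : IsTorsionTheoryFG (extendsFG d) (detectedFG d)) [Module.Finite A M]
    (hM : ∀ (Y : Type u) [AddCommGroup Y] [Module A Y] [Module.Finite A Y],
      Module.Finite A (BimoduleHom A M Y)) :
    (∀ X : ModuleCat.{u} A, extendsFG d X → extendsFG d (bimoduleTensor M X)) ↔
      ∀ Y : ModuleCat.{u} A, detectedFG d Y → detectedFG d (bimoduleHom M Y) := by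
  constructor
  · intro hX Y hY
    have : Module.Finite A Y := hY.2
    have := hM Y
    -- For torsion N, maps N → Hom_A(M, Y) correspond to maps M ⊗ N → Y from a torsion to a
    -- torsionfree module.
    refine ⟨h.detectedAlong (Z := BimoduleHom A M Y) fun N _ _ _ hN => ?_, this⟩
    refine (forall_balancedTensor_eq_zero_iff M N Y).1 fun φ => ?_
    exact linearMap_eq_zero_of_meetInZero h.meetInZero
      (hX (ModuleCat.of A N) ((extendsFG_iff d _).2 ⟨hN, inferInstance⟩)).1 hY.1 φ
  · intro hY X hX
    have : Module.Finite A X := hX.2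
    have := finite_balancedTensor (A := A) (M := M) (X := X)
    refine ⟨h.extendsAlong (Z := BalancedTensor (A := A) M X) fun N _ _ _ hN => ?_, this⟩
    refine (forall_balancedTensor_eq_zero_iff M X N).2 fun ψ => ?_
    have : Module.Finite A (bimoduleHom M (ModuleCat.of A N)) := hM N
    exact linearMap_eq_zero_of_meetInZero h.meetInZero hX.1
      (hY (ModuleCat.of A N) ((detectedFG_iff d _).2 ⟨hN, inferInstance⟩)).1 ψ

end Adjunction

/-! ### Finite generation of DA and of Hom_A(DA, Y) -/

section DualFinite

variable {R : Type u} [CommRing R] {A : Type u} [Ring A] [Algebra R A] [Module.Finite R A]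
  {I : Type u} [AddCommGroup I] [Module R I]

/-- Evaluation at generators of A over R embeds DA into a finite power of the noetherian module I.
-/
lemma finite_dualModule [IsNoetherian R I] : Module.Finite A (DualModule R A I) := by
  let : Module R (DualModule R A I) := inferInstanceAs (Module R (A →ₗ[R] I))
  have : IsScalarTower R A (DualModule R A I) := ⟨fun r a f => LinearMap.ext fun x => by
    change f.lin (x * (r • a)) = r • f.lin (x * a)
    rw [mul_smul_comm, map_smul]⟩
  obtain ⟨n, x, hx⟩ := Module.Finite.exists_fin (R := R) (M := A)
  let φ : (A →ₗ[R] I) →ₗ[R] (Fin n → I) := LinearMap.pi fun i => LinearMap.applyₗ (x i)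
  have hφ : Function.Injective φ := fun f g hfg =>
    LinearMap.ext_on_range hx fun i => congrFun hfg i
  have : IsNoetherian R (A →ₗ[R] I) := isNoetherian_of_injective φ hφ
  have : Module.Finite R (DualModule R A I) :=
    inferInstanceAs (Module.Finite R (A →ₗ[R] I))
  exact Module.Finite.of_restrictScalars_finite R A _

lemma finite_bimoduleHom_dualModule [IsNoetherianRing R] [IsNoetherian R I]
    (Y : Type u) [AddCommGroup Y] [Module A Y] [Module.Finite A Y] :
    Module.Finite A (BimoduleHom A (DualModule R A I) Y) := by
  let : Module R Y := Module.compHom Y (algebraMap R A)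
  have : IsScalarTower R A Y := IsScalarTower.of_algebraMap_smul fun _ _ => rfl
  have : Module.Finite R Y := Module.Finite.trans A Y
  have := finite_dualModule (R := R) (A := A) (I := I)
  let : Module R (BimoduleHom A (DualModule R A I) Y) :=
    inferInstanceAs (Module R (DualModule R A I →ₗ[A] Y))
  have : IsScalarTower R A (BimoduleHom A (DualModule R A I) Y) :=
    IsScalarTower.of_algebraMap_smul fun r g => LinearMap.ext fun f => by
      -- A acts through DA and R through Y; the two agree on R because R is central in A.
      change g.lin _ (MulOpposite.op (algebraMap R A r) • f) = algebraMap R A r • g.lin _ f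
      rw [← map_smul]
      congr 1
      refine LinearMap.ext fun x => ?_
      change f.lin (algebraMap R A r * x) = f.lin (x * algebraMap R A r)
      rw [Algebra.commutes]
  obtain ⟨n, x, hx⟩ := Module.Finite.exists_fin (R := A) (M := DualModule R A I)
  let φ : (DualModule R A I →ₗ[A] Y) →ₗ[R] (Fin n → Y) :=
    LinearMap.pi fun i =>
      { toFun := fun g => g (x i), map_add' := fun _ _ => rfl, map_smul' := fun _ _ => rfl }
  have hφ : Function.Injective φ := fun f g hfg =>
    LinearMap.ext_on_range hx fun i => congrFun hfg i
  have : IsNoetherian R (DualModule R A I →ₗ[A] Y) :=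
    isNoetherian_of_injective φ hφ
  have : Module.Finite R (BimoduleHom A (DualModule R A I) Y) :=
    inferInstanceAs (Module.Finite R (DualModule R A I →ₗ[A] Y))
  exact Module.Finite.of_restrictScalars_finite R A _

end DualFinite

/-! ### Duality between Hom_A(Q, DA ⊗ X) and Hom_A(X, Q) for projective Q -/

section Nakayama

variable {R : Type u} [CommRing R] {A : Type u} [Ring A] [Algebra R A]
  {I : Type u} [AddCommGroup I] [Module R I]
  {X : Type u} [AddCommGroup X] [Module A X]

variable (A) in
/-- The element of `DA` given by a linear map. -/
def DualModule.ofLin (f : A →ₗ[R] I) : DualModule R A I := f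

/-- The functional on `Hom_A(X, A)` given by an element of `DA ⊗_ℤ X`. -/
def dualPairingAux : (DualModule R A I ⊗[ℤ] X) →+ ((X →ₗ[A] A) →ₗ[R] I) :=
  intLift (AddMonoidHom.mk' (fun f => AddMonoidHom.mk' (fun x =>
      { toFun := fun ξ => f.lin (ξ x)
        map_add' := fun ξ η => map_add f.lin _ _
        map_smul' := fun r ξ => map_smul f.lin _ _ })
      fun x y => by ext ξ; simp) fun f g => rfl)

lemma dualPairingAux_tmul (f : DualModule R A I) (x : X) (ξ : X →ₗ[A] A) :
    dualPairingAux (f ⊗ₜ[ℤ] x) ξ = f.lin (ξ x) := rfl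

/-- The left action on DA corresponds to following ξ by right multiplication by a, which is left
A-linear. -/
lemma dualPairingAux_smul (a : A) (t : DualModule R A I ⊗[ℤ] X) (ξ : X →ₗ[A] A) :
    dualPairingAux (a • t) ξ = dualPairingAux t (LinearMap.toSpanSingleton A A a ∘ₗ ξ) := by
  induction t with
  | zero => simp
  | tmul f x => rfl
  | add s t hs ht => rw [smul_add, map_add, LinearMap.add_apply, hs, ht, map_add,
      LinearMap.add_apply]

/-- The functional on `Hom_A(X, A)` given by an element of `DA ⊗_A X`. -/
def dualPairing : BalancedTensor (A := A) (DualModule R A I) X →+ ((X →ₗ[A] A) →ₗ[R] I) :=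
  QuotientAddGroup.lift (balancedRelations (A := A) (DualModule R A I) X).toAddSubgroup
    dualPairingAux (by
      -- The relations are given as an A-span, so the kernel of the pairing has to be recognised as
      -- an A-submodule.
      let K : Submodule A (DualModule R A I ⊗[ℤ] X) :=
        { carrier := {t | dualPairingAux t = 0}
          add_mem' := fun {s t} hs ht => by
            rw [Set.mem_ofPred_eq] at *
            rw [map_add, hs, ht, add_zero]
          zero_mem' := map_zero _
          smul_mem' := fun a t ht => by
            rw [Set.mem_ofPred_eq] at *
            ext ξ
            rw [dualPairingAux_smul, ht]
            rfl }
      change balancedRelations (A := A) (DualModule R A I) X ≤ K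
      rw [balancedRelations, Submodule.span_le]
      rintro _ ⟨f, a, x, rfl⟩
      change dualPairingAux _ = 0
      rw [map_sub, sub_eq_zero]
      ext ξ
      rw [dualPairingAux_tmul, dualPairingAux_tmul, map_smul]
      rfl)

lemma dualPairing_smul (a : A) (t : BalancedTensor (A := A) (DualModule R A I) X)
    (ξ : X →ₗ[A] A) :
    dualPairing (a • t) ξ = dualPairing t (LinearMap.toSpanSingleton A A a ∘ₗ ξ) := by
  obtain ⟨t, rfl⟩ := Submodule.Quotient.mk_surjective _ t
  exact dualPairingAux_smul a t ξ

lemma dualPairing_sum {n : ℕ} (x : Fin n → X) (f : Fin n → DualModule R A I) (ξ : X →ₗ[A] A) :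
    dualPairing (balancedSum (A := A) x f) ξ = ∑ i, (f i).lin (ξ (x i)) := by
  rw [balancedSum_apply, map_sum, LinearMap.sum_apply]
  rfl

/-- The trace pairing of a linear map `Q → DA ⊗_A X` with linear maps `X → Q`: a functional on
`Hom_A(X, Q)` whose value at the rank one maps `x ↦ ξ(x) q` is given by `dualPairing`. -/
lemma exists_trace {Q : Type u} [AddCommGroup Q] [Module A Q] [Module R Q] [IsScalarTower R A Q]
    [Module.Finite A Q] [Module.Projective A Q]
    (g : Q →ₗ[A] BalancedTensor (A := A) (DualModule R A I) X) :
    ∃ τ : (X →ₗ[A] Q) →ₗ[R] I, ∀ (ξ : X →ₗ[A] A) (q : Q),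
      τ (LinearMap.toSpanSingleton A Q q ∘ₗ ξ) = dualPairing (g q) ξ := by
  obtain ⟨n, π, σ, -, -, hπσ⟩ := Module.Finite.exists_comp_eq_id_of_projective A Q
  let e : Fin n → Q := fun i => π (Pi.single i 1)
  let ζ : Fin n → (Q →ₗ[A] A) := fun i => LinearMap.proj i ∘ₗ σ
  have hdual : ∀ q, ∑ i, ζ i q • e i = q := fun q => by
    have h1 : π (σ q) = q := LinearMap.congr_fun hπσ q
    conv_rhs => rw [← h1, ← Finset.univ_sum_single (σ q), map_sum]
    refine Finset.sum_congr rfl fun i _ => ?_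
    rw [← map_smul, ← Pi.single_smul, smul_eq_mul, mul_one]
    rfl
  -- With the dual basis (eᵢ, ζᵢ) of Q, the trace of h is the sum of the pairings of g(eᵢ) with ζᵢ ∘
  -- h.
  refine ⟨∑ i, dualPairing (g (e i)) ∘ₗ
    { toFun := fun h => ζ i ∘ₗ h
      map_add' := fun _ _ => LinearMap.comp_add _ _ _
      map_smul' := fun r h => LinearMap.ext fun x => (ζ i).map_smul_of_tower r (h x) }, fun ξ q => ?_⟩
  rw [LinearMap.sum_apply]
  conv_rhs => rw [← hdual q, map_sum, map_sum, LinearMap.sum_apply]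
  refine Finset.sum_congr rfl fun i _ => ?_
  rw [map_smul, dualPairing_smul]
  change dualPairing (g (e i)) (ζ i ∘ₗ LinearMap.toSpanSingleton A Q q ∘ₗ ξ) = _
  congr 1
  ext x
  simp

/-- A functional on `Hom_A(X, Q)` is determined by its values at rank one maps. -/
lemma functional_ext {Q : Type u} [AddCommGroup Q] [Module A Q] [Module R Q]
    [IsScalarTower R A Q] [Module.Finite A Q] [Module.Projective A Q]
    {l m : (X →ₗ[A] Q) →ₗ[R] I}
    (h : ∀ (ξ : X →ₗ[A] A) (q : Q), l (LinearMap.toSpanSingleton A Q q ∘ₗ ξ) =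
      m (LinearMap.toSpanSingleton A Q q ∘ₗ ξ)) : l = m := by
  obtain ⟨n, π, σ, -, -, hπσ⟩ := Module.Finite.exists_comp_eq_id_of_projective A Q
  ext f
  have hf : f = ∑ i, LinearMap.toSpanSingleton A Q (π (Pi.single i 1)) ∘ₗ
      (LinearMap.proj i ∘ₗ σ ∘ₗ f) := by
    ext x
    have h1 : π (σ (f x)) = f x := LinearMap.congr_fun hπσ (f x)
    conv_lhs => rw [← h1, ← Finset.univ_sum_single (σ (f x)), map_sum]
    rw [LinearMap.sum_apply]
    refine Finset.sum_congr rfl fun i _ => ?_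
    simp [← map_smul, ← Pi.single_smul]
  rw [hf, map_sum, map_sum]
  exact Finset.sum_congr rfl fun i _ => h _ _

variable [Module.Finite A X]

/-- Evaluation at generators xᵢ of X embeds Hom_A(X, A) into Aⁿ. A functional extends to Aⁿ by
injectivity of I, and its components Φᵢ give the preimage ∑ Φᵢ ⊗ xᵢ. -/
lemma dualPairing_surjective [Module.Injective R I] :
    Function.Surjective (dualPairing (R := R) (A := A) (I := I) (X := X)) := by
  intro l
  obtain ⟨n, x, hx⟩ := Module.Finite.exists_fin (R := A) (M := X)
  let ev : (X →ₗ[A] A) →ₗ[R] (Fin n → A) := LinearMap.pi fun i =>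
    { toFun := fun g => g (x i), map_add' := fun _ _ => rfl, map_smul' := fun _ _ => rfl }
  obtain ⟨Φ, hΦ⟩ := Module.Injective.out ev
    (fun f g hfg => LinearMap.ext_on_range hx fun i => congrFun hfg i) l
  refine ⟨balancedSum x fun i => DualModule.ofLin A (Φ ∘ₗ LinearMap.single R (fun _ => A) i), ?_⟩
  ext ξ
  rw [dualPairing_sum, ← hΦ]
  change ∑ i, Φ (Pi.single i (ev ξ i)) = _
  rw [← map_sum, Finset.univ_sum_single]

lemma exists_comp_eq_of_ker_le [Module.Injective R I] {M N : Type u} [AddCommGroup M]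
    [Module R M] [AddCommGroup N] [Module R N] (Θ : M →ₗ[R] N) (F : M →ₗ[R] I)
    (h : LinearMap.ker Θ ≤ LinearMap.ker F) : ∃ G : N →ₗ[R] I, ∀ x, G (Θ x) = F x := by
  obtain ⟨G, hG⟩ := Module.Injective.out ((LinearMap.ker Θ).liftQ Θ le_rfl)
    (LinearMap.ker_eq_bot.1 (Submodule.ker_liftQ_eq_bot' _ _ rfl)) ((LinearMap.ker Θ).liftQ F h)
  exact ⟨G, fun x => hG (Submodule.Quotient.mk x)⟩

/-- Let t = ∑ fᵢ ⊗ xᵢ pair to zero, and let kⱼ generate the relations among the xᵢ. A vector a in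
the kernel of Θ respects these relations, so it defines ξ with ξ(xᵢ) = aᵢ, and F(a) = ∑ fᵢ(aᵢ) = 0.
Hence F = G ∘ Θ, which writes fᵢ = ∑ⱼ Gⱼ kⱼᵢ; moving kⱼᵢ across the tensor sign leaves the relations
∑ᵢ kⱼᵢ xᵢ = 0. -/
lemma dualPairing_injective [Module.Injective R I] [IsNoetherianRing A] :
    Function.Injective (dualPairing (R := R) (A := A) (I := I) (X := X)) := by
  rw [injective_iff_map_eq_zero]
  intro t ht
  obtain ⟨n, x, hx⟩ := Module.Finite.exists_fin (R := A) (M := X)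
  obtain ⟨f, rfl⟩ := balancedSum_surjective hx t
  let π : (Fin n → A) →ₗ[A] X := Fintype.linearCombination A x
  have hπ : Function.Surjective π := by
    rw [← LinearMap.range_eq_top, Fintype.range_linearCombination, hx]
  obtain ⟨m, k, hk⟩ := Submodule.fg_iff_exists_fin_generating_family.1
    (IsNoetherian.noetherian (LinearMap.ker π))
  have hkπ : ∀ j, π (k j) = 0 := fun j => by
    have : k j ∈ LinearMap.ker π := hk ▸ Submodule.subset_span ⟨j, rfl⟩
    exact this
  let Θ : (Fin n → A) →ₗ[R] (Fin m → A) :=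
    LinearMap.pi fun j => ∑ i, LinearMap.mulLeft R (k j i) ∘ₗ LinearMap.proj i
  have hΘ : ∀ a j, Θ a j = ∑ i, k j i * a i := fun a j => by simp [Θ]
  let F : (Fin n → A) →ₗ[R] I := ∑ i, (f i).lin ∘ₗ LinearMap.proj i
  have hF : ∀ a, F a = ∑ i, (f i).lin (a i) := fun a => by simp [F]
  obtain ⟨G, hG⟩ := exists_comp_eq_of_ker_le Θ F fun a ha => by
    let η : (Fin n → A) →ₗ[A] A := Fintype.linearCombination A a
    have hη : LinearMap.ker π ≤ LinearMap.ker η := by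
      rw [← hk, Submodule.span_le]
      rintro _ ⟨j, rfl⟩
      have := congrFun (LinearMap.mem_ker.1 ha) j
      rw [hΘ] at this
      simpa [η, Fintype.linearCombination_apply] using this
    let ξ : X →ₗ[A] A := (LinearMap.ker π).liftQ η hη ∘ₗ
      (π.quotKerEquivOfSurjective hπ).symm.toLinearMap
    have hξ : ∀ i, ξ (x i) = a i := fun i => by
      have hxi : x i = π.quotKerEquivOfSurjective hπ (Submodule.Quotient.mk (Pi.single i 1)) := by
        simp [π, LinearMap.quotKerEquivOfSurjective]
      rw [hxi]
      simp [ξ, η]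
    have := LinearMap.congr_fun ht ξ
    rw [dualPairing_sum] at this
    simp only [hξ] at this
    rw [LinearMap.mem_ker, hF]
    exact this
  have hf : ∀ i, f i = ∑ j, MulOpposite.op (k j i) •
      (DualModule.ofLin A (G ∘ₗ LinearMap.single R (fun _ => A) j)) := by
    intro i
    refine LinearMap.ext fun a => ?_
    have h1 : (f i).lin a = F (Pi.single i a) := by
      rw [hF, Finset.sum_eq_single i]
      · rw [Pi.single_eq_same]
      · intro l _ hl
        rw [Pi.single_eq_of_ne hl, map_zero]
      · simp
    have h2 : Θ (Pi.single i a) = ∑ j, Pi.single j (k j i * a) := by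
      ext j
      rw [Finset.univ_sum_single, hΘ, Finset.sum_eq_single i]
      · rw [Pi.single_eq_same]
      · intro l _ hl
        rw [Pi.single_eq_of_ne hl, mul_zero]
      · simp
    change (f i).lin a = _
    rw [h1, ← hG, h2, map_sum]
    exact (map_sum (AddMonoidHom.mk' (fun f : DualModule R A I => f.lin a) fun _ _ => rfl)
      (fun j => MulOpposite.op (k j i) •
        DualModule.ofLin A (G ∘ₗ LinearMap.single R (fun _ => A) j)) Finset.univ).symm
  rw [balancedSum_apply]
  calc ∑ i, balancedTmul (A := A) (f i) (x i)
      = ∑ i, ∑ j, balancedTmul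
          (DualModule.ofLin A (G ∘ₗ LinearMap.single R (fun _ => A) j)) (k j i • x i) := by
        refine Finset.sum_congr rfl fun i _ => ?_
        rw [hf i, sum_balancedTmul]
        exact Finset.sum_congr rfl fun j _ => op_smul_balancedTmul _ _ _
    _ = 0 := by
        rw [Finset.sum_comm]
        refine Finset.sum_eq_zero fun j _ => ?_
        rw [← balancedTmul_sum, show ∑ i, k j i • x i = π (k j) from
          (Fintype.linearCombination_apply A x (k j)).symm, hkπ]
        exact map_zero (balancedTmulRight (A := A) _)

/-- Every functional on `Hom_A(X, Q)` is the trace pairing with a map `Q → DA ⊗_A X`. -/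
lemma exists_linearMap_of_functional [Module.Injective R I] [IsNoetherianRing A] {Q : Type u}
    [AddCommGroup Q] [Module A Q] [Module R Q] [IsScalarTower R A Q]
    (l : (X →ₗ[A] Q) →ₗ[R] I) :
    ∃ g : Q →ₗ[A] BalancedTensor (A := A) (DualModule R A I) X, ∀ (ξ : X →ₗ[A] A) (q : Q),
      dualPairing (g q) ξ = l (LinearMap.toSpanSingleton A Q q ∘ₗ ξ) := by
  have hinj := dualPairing_injective (R := R) (A := A) (I := I) (X := X)
  -- Surjectivity of the pairing gives g pointwise; injectivity makes it linear.
  have hex : ∀ q : Q, ∃ t : BalancedTensor (A := A) (DualModule R A I) X, ∀ ξ : X →ₗ[A] A,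
      dualPairing t ξ = l (LinearMap.toSpanSingleton A Q q ∘ₗ ξ) := fun q => by
    obtain ⟨t, ht⟩ := dualPairing_surjective (R := R) (A := A) (I := I) (X := X)
      (l ∘ₗ { toFun := fun ξ => LinearMap.toSpanSingleton A Q q ∘ₗ ξ
              map_add' := fun _ _ => LinearMap.comp_add _ _ _
              map_smul' := fun r ξ => by ext x; simp })
    exact ⟨t, fun ξ => LinearMap.congr_fun ht ξ⟩
  choose g hg using hex
  refine ⟨{ toFun := g, map_add' := fun p q => hinj ?_, map_smul' := fun a q => hinj ?_ },
    fun ξ q => hg q ξ⟩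
  · ext ξ
    rw [map_add, LinearMap.add_apply, hg, hg, hg, ← map_add]
    congr 1
    ext x
    simp
  · ext ξ
    rw [RingHom.id_apply, dualPairing_smul, hg, hg]
    congr 1
    ext x
    simp [mul_smul]

variable {P₁ P₀ : Type u} [AddCommGroup P₁] [Module A P₁] [AddCommGroup P₀] [Module A P₀]
  [Module.Finite A P₁] [Module.Projective A P₁] [Module.Finite A P₀] [Module.Projective A P₀]

/-- For `d : P₁ → P₀` between finitely generated projective modules, every map
`P₁ → DA ⊗_A X` extends along `d` if and only if there are no nonzero maps from `X` to the kernel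
of `d`. -/
lemma extendsAlong_dualTensor_iff [IsNoetherianRing A] {j : (R ⧸ Ring.jacobson R) →ₗ[R] I}
    [IsArtinianRing R] (hj : IsInjectiveEnvelope R j) (d : P₁ →ₗ[A] P₀) :
    ExtendsAlong d (BalancedTensor (A := A) (DualModule R A I) X) ↔
      ∀ h : X →ₗ[A] P₁, d ∘ₗ h = 0 → h = 0 := by
  let : Module R P₁ := Module.compHom P₁ (algebraMap R A)
  have : IsScalarTower R A P₁ := IsScalarTower.of_algebraMap_smul fun _ _ => rfl
  let : Module R P₀ := Module.compHom P₀ (algebraMap R A)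
  have : IsScalarTower R A P₀ := IsScalarTower.of_algebraMap_smul fun _ _ => rfl
  have := hj.injective_module
  let dX : (X →ₗ[A] P₁) →ₗ[R] (X →ₗ[A] P₀) :=
    { toFun := fun h => d ∘ₗ h
      map_add' := fun _ _ => LinearMap.comp_add _ _ _
      map_smul' := fun r h => LinearMap.ext fun x => d.map_smul_of_tower r (h x) }
  have hdX : ∀ (ξ : X →ₗ[A] A) (q : P₁), dX (LinearMap.toSpanSingleton A P₁ q ∘ₗ ξ) =
      LinearMap.toSpanSingleton A P₀ (d q) ∘ₗ ξ := fun ξ q => by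
    ext x
    simp [dX]
  constructor
  · intro hext h hh
    -- If d ∘ h = 0 with h ≠ 0, a functional l with l(h) ≠ 0 comes from a map f on P₁. Extending f
    -- along d makes l factor through composition with d, so l(h) = 0.
    by_contra hne
    obtain ⟨l, hl⟩ := hj.exists_apply_ne_zero hne
    obtain ⟨f, hf⟩ := exists_linearMap_of_functional l
    obtain ⟨g, rfl⟩ := hext f
    obtain ⟨τ, hτ⟩ := exists_trace g
    have : l = τ ∘ₗ dX := functional_ext fun ξ q => by
      rw [LinearMap.comp_apply, hdX, hτ, ← hf]
      rfl
    refine hl ?_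
    rw [this]
    change τ (d ∘ₗ h) = 0
    rw [hh, map_zero]
  · intro hinj f
    obtain ⟨l, hl⟩ := exists_trace f
    -- Composition with d is injective, so the functional of f extends along it, and the extension
    -- is the functional of the wanted g.
    obtain ⟨m, hm⟩ := exists_comp_eq_of_ker_le dX l (fun h hh => by
      have h0 : h = 0 := hinj h hh
      rw [h0]
      exact zero_mem _)
    obtain ⟨g, hg⟩ := exists_linearMap_of_functional m
    refine ⟨g, LinearMap.ext fun q => ?_⟩
    refine dualPairing_injective (R := R) (A := A) (I := I) (X := X) ?_
    ext ξ
    rw [LinearMap.comp_apply, hg, ← hdX, hm, hl]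

/-- For a torsion theory, the kernel of `d` is torsionfree if and only if the torsion class is
stable under `DA ⊗_A -`. -/
lemma IsTorsionTheoryFG.detectedAlong_ker_iff [Module.Finite R A] [IsNoetherianRing A]
    {j : (R ⧸ Ring.jacobson R) →ₗ[R] I} [IsArtinianRing R] (hj : IsInjectiveEnvelope R j)
    {d : P₁ →ₗ[A] P₀} (h : IsTorsionTheoryFG (extendsFG d) (detectedFG d)) :
    DetectedAlong d (LinearMap.ker d) ↔ ∀ X : ModuleCat.{u} A, extendsFG d X →
      extendsFG d (bimoduleTensor (DualModule R A I) X) := by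
  have := hj.isNoetherian
  have := finite_dualModule (R := R) (A := A) (I := I)
  constructor
  · intro hd X hX
    have : Module.Finite A X := hX.2
    refine ⟨(extendsAlong_dualTensor_iff hj d).2 fun f hf => ?_,
      finite_balancedTensor (A := A) (M := DualModule R A I) (X := X)⟩
    have h0 := linearMap_eq_zero_of_meetInZero h.meetInZero hX.1 hd
      (LinearMap.codRestrict (LinearMap.ker d) f fun x => LinearMap.congr_fun hf x)
    ext x
    exact congrArg Subtype.val (LinearMap.congr_fun h0 x)
  · intro hX
    refine h.detectedAlong fun M _ _ _ hM f => ?_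
    have h1 := (hX (ModuleCat.of A M) ((extendsFG_iff d _).2 ⟨hM, inferInstance⟩)).1
    have h2 := (extendsAlong_dualTensor_iff hj d).1 h1 ((LinearMap.ker d).subtype ∘ₗ f) (by
      ext x
      exact (f x).2)
    ext x
    exact LinearMap.congr_fun h2 x

end Nakayama

/-! ### Maps from a projective placed in one degree are maps to homology -/

section SingleHomology

variable {C : Type*} [Category* C] [Abelian C]

variable (C) in
/-- The homology in degree `i` of the complex concentrated in degree `i`. -/
def singleCompHomologyIso (i : ℤ) :
    HomotopyCategory.singleFunctor C i ⋙
      HomotopyCategory.homologyFunctor C (ComplexShape.up ℤ) i ≅ 𝟭 C :=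
  Functor.isoWhiskerLeft (CochainComplex.singleFunctor C i)
      (HomotopyCategory.homologyFunctorFactors C (ComplexShape.up ℤ) i) ≪≫
    HomologicalComplex.homologyFunctorSingleIso C (ComplexShape.up ℤ) i

variable {i : ℤ} {Q Q' : C} {X Y : HomotopyCategory C (ComplexShape.up ℤ)}

/-- The morphism `Q ⟶ Hⁱ(X)` given by a morphism to `X` from `Q` placed in degree `i`. -/
def homologyEval (f : (HomotopyCategory.singleFunctor C i).obj Q ⟶ X) :
    Q ⟶ (HomotopyCategory.homologyFunctor C (ComplexShape.up ℤ) i).obj X :=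
  (singleCompHomologyIso C i).inv.app Q ≫
    (HomotopyCategory.homologyFunctor C (ComplexShape.up ℤ) i).map f

lemma homologyEval_precomp (g : Q' ⟶ Q)
    (f : (HomotopyCategory.singleFunctor C i).obj Q ⟶ X) :
    homologyEval ((HomotopyCategory.singleFunctor C i).map g ≫ f) = g ≫ homologyEval f := by
  have := (singleCompHomologyIso C i).inv.naturality g
  dsimp only [Functor.id_map, Functor.comp_map] at this
  rw [homologyEval, homologyEval, Functor.map_comp, ← Category.assoc, ← this, Category.assoc]

lemma homologyEval_add (f g : (HomotopyCategory.singleFunctor C i).obj Q ⟶ X) :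
    homologyEval (f + g) = homologyEval f + homologyEval g := by
  rw [homologyEval, Functor.map_add, Preadditive.comp_add]
  rfl

lemma homotopyHomologyFunctor_map_quotient_map {L K : CochainComplex C ℤ} (φ : L ⟶ K) :
    (HomotopyCategory.homologyFunctor C (ComplexShape.up ℤ) i).map
      ((HomotopyCategory.quotient C (ComplexShape.up ℤ)).map φ) =
      (HomotopyCategory.homologyFunctorFactors C (ComplexShape.up ℤ) i).hom.app L ≫
        (HomologicalComplex.homologyFunctor C (ComplexShape.up ℤ) i).map φ ≫
        (HomotopyCategory.homologyFunctorFactors C (ComplexShape.up ℤ) i).inv.app K := by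
  have := (HomotopyCategory.homologyFunctorFactors C (ComplexShape.up ℤ) i).hom.naturality_assoc
    φ ((HomotopyCategory.homologyFunctorFactors C (ComplexShape.up ℤ) i).inv.app K)
  rw [Iso.hom_inv_id_app] at this
  exact (Category.comp_id _).symm.trans this

lemma homologyEval_quotient_map {K : CochainComplex C ℤ}
    (φ : (HomologicalComplex.single C (ComplexShape.up ℤ) i).obj Q ⟶ K) :
    homologyEval (X := (HomotopyCategory.quotient _ _).obj K)
        ((HomotopyCategory.quotient C (ComplexShape.up ℤ)).map φ) =
      (HomologicalComplex.homologyFunctorSingleIso C (ComplexShape.up ℤ) i).inv.app Q ≫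
        (HomologicalComplex.homologyFunctor C (ComplexShape.up ℤ) i).map φ ≫
        (HomotopyCategory.homologyFunctorFactors C (ComplexShape.up ℤ) i).inv.app K := by
  have h' : (singleCompHomologyIso C i).inv.app Q =
      (HomologicalComplex.homologyFunctorSingleIso C (ComplexShape.up ℤ) i).inv.app Q ≫
        (HomotopyCategory.homologyFunctorFactors C (ComplexShape.up ℤ) i).inv.app
          ((HomologicalComplex.single C (ComplexShape.up ℤ) i).obj Q) := rfl
  refine (congrArg₂ (· ≫ ·) h' (homotopyHomologyFunctor_map_quotient_map φ)).trans ?_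
  exact (Category.assoc _ _ _).trans (congrArg (_ ≫ ·) (Iso.inv_hom_id_app_assoc _ _ _))

/-- The resulting map from Q to cycles has zero class, so by projectivity it lifts through the
boundaries. -/
lemma exists_comp_d_eq_of_homologyMap_eq_zero [Projective Q] {K : CochainComplex C ℤ}
    (φ : (HomologicalComplex.single C (ComplexShape.up ℤ) i).obj Q ⟶ K)
    (h : HomologicalComplex.homologyMap φ i = 0) :
    ∃ g : Q ⟶ K.X (i - 1), g ≫ K.d (i - 1) i =
      (HomologicalComplex.singleObjXSelf (ComplexShape.up ℤ) i Q).inv ≫ φ.f i := by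
  obtain ⟨c, hcdef⟩ : ∃ c : Q ⟶ K.cycles i, c =
    (HomologicalComplex.singleObjCyclesSelfIso (ComplexShape.up ℤ) i Q).inv ≫
      HomologicalComplex.cyclesMap φ i := ⟨_, rfl⟩
  have hc : c ≫ K.homologyπ i = 0 := by
    rw [hcdef, Category.assoc, ← HomologicalComplex.homologyπ_naturality, h, comp_zero, comp_zero]
  have hci : c ≫ K.iCycles i =
      (HomologicalComplex.singleObjXSelf (ComplexShape.up ℤ) i Q).inv ≫ φ.f i := by
    rw [hcdef, Category.assoc, HomologicalComplex.cyclesMap_i, ← Category.assoc,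
      HomologicalComplex.singleObjCyclesSelfIso_inv_iCycles]
  have hex : (ShortComplex.mk (K.toCycles (i - 1) i) (K.homologyπ i) (by simp)).Exact :=
    ShortComplex.exact_of_g_is_cokernel _ (K.homologyIsCokernel (i - 1) i (by simp))
  refine ⟨hex.liftFromProjective c hc, ?_⟩
  rw [← hci, ← HomologicalComplex.toCycles_i, ← Category.assoc]
  congr 1
  exact hex.liftFromProjective_comp c hc

lemma exists_homologyMap_eq [Projective Q] {K : CochainComplex C ℤ} (ψ : Q ⟶ K.homology i) :
    ∃ φ : (HomologicalComplex.single C (ComplexShape.up ℤ) i).obj Q ⟶ K,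
      HomologicalComplex.homologyMap φ i =
        (HomologicalComplex.singleObjHomologySelfIso (ComplexShape.up ℤ) i Q).hom ≫ ψ := by
  obtain ⟨c, hc⟩ : ∃ c : Q ⟶ K.cycles i, c ≫ K.homologyπ i = ψ :=
    ⟨_, Projective.factorThru_comp ψ (K.homologyπ i)⟩
  let φ : (HomologicalComplex.single C (ComplexShape.up ℤ) i).obj Q ⟶ K :=
    HomologicalComplex.mkHomFromSingle (c ≫ K.iCycles i) (by simp)
  refine ⟨φ, ?_⟩
  have hφ : HomologicalComplex.cyclesMap φ i =
      (HomologicalComplex.singleObjCyclesSelfIso (ComplexShape.up ℤ) i Q).hom ≫ c := by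
    rw [← cancel_mono (K.iCycles i), HomologicalComplex.cyclesMap_i, Category.assoc,
      HomologicalComplex.singleObjCyclesSelfIso_hom, HomologicalComplex.mkHomFromSingle_f]
    simp
  rw [← cancel_epi (HomologicalComplex.homologyπ _ i), HomologicalComplex.homologyπ_naturality,
    hφ, HomologicalComplex.homologyπ_singleObjHomologySelfIso_hom_assoc, Category.assoc, hc]

lemma homologyEval_injective [Projective Q] :
    Function.Injective
      (homologyEval : ((HomotopyCategory.singleFunctor C i).obj Q ⟶ X) → _) := by
  let F : ((HomotopyCategory.singleFunctor C i).obj Q ⟶ X) →+ _ :=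
    AddMonoidHom.mk' homologyEval homologyEval_add
  refine (injective_iff_map_eq_zero F).2 fun f hf => ?_
  change homologyEval f = 0 at hf
  obtain ⟨K, rfl⟩ := HomotopyCategory.quotient_obj_surjective X
  obtain ⟨φ, rfl⟩ := (HomotopyCategory.quotient C (ComplexShape.up ℤ)).map_surjective
    (X := (HomologicalComplex.single C (ComplexShape.up ℤ) i).obj Q) f
  have h1 : (HomologicalComplex.homologyFunctorSingleIso C (ComplexShape.up ℤ) i).inv.app Q ≫
        (HomologicalComplex.homologyFunctor C (ComplexShape.up ℤ) i).map φ ≫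
        (HomotopyCategory.homologyFunctorFactors C (ComplexShape.up ℤ) i).inv.app K = 0 :=
    (homologyEval_quotient_map φ).symm.trans hf
  have h0 : HomologicalComplex.homologyMap φ i = 0 := by
    rw [← IsIso.eq_inv_comp, comp_zero] at h1
    rw [← IsIso.eq_comp_inv, zero_comp] at h1
    exact h1
  obtain ⟨g, hg⟩ := exists_comp_d_eq_of_homologyMap_eq_zero φ h0
  -- The lift g, as a cochain of degree -1, has differential φ and is therefore a null-homotopy.
  have e1 := CochainComplex.HomComplex.Cochain.δ_fromSingleMk g (p := i) (n := -1) (by lia) 0 i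
    (by lia)
  have e2 : CochainComplex.HomComplex.Cochain.fromSingleMk
      ((HomologicalComplex.singleObjXSelf (ComplexShape.up ℤ) i Q).inv ≫ φ.f i) (add_zero i) =
      CochainComplex.HomComplex.Cochain.ofHom φ := by
    refine (CochainComplex.HomComplex.Cochain.fromSingleEquiv (add_zero i)).injective
      ((CochainComplex.HomComplex.Cochain.fromSingleEquiv_fromSingleMk _ _).trans ?_)
    exact congrArg ((HomologicalComplex.singleObjXSelf (ComplexShape.up ℤ) i Q).inv ≫ ·)
      (CochainComplex.HomComplex.Cochain.ofHom_v φ i).symm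
  refine (HomotopyCategory.quotient_map_eq_zero_iff _).2
    ⟨(CochainComplex.HomComplex.Cochain.equivHomotopy φ 0).symm
      ⟨CochainComplex.HomComplex.Cochain.fromSingleMk g (by lia), ?_⟩⟩
  rw [CochainComplex.HomComplex.Cochain.ofHom_zero, add_zero]
  exact e2.symm.trans ((congrArg (CochainComplex.HomComplex.Cochain.fromSingleMk ·
    (add_zero i)) hg.symm).trans e1.symm)

lemma homologyEval_surjective [Projective Q] :
    Function.Surjective
      (homologyEval : ((HomotopyCategory.singleFunctor C i).obj Q ⟶ X) → _) := by
  intro ψ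
  obtain ⟨K, rfl⟩ := HomotopyCategory.quotient_obj_surjective X
  obtain ⟨φ, hφ⟩ := exists_homologyMap_eq (K := K)
    (ψ ≫ (HomotopyCategory.homologyFunctorFactors C (ComplexShape.up ℤ) i).hom.app K)
  refine ⟨(HomotopyCategory.quotient C (ComplexShape.up ℤ)).map φ,
    (homologyEval_quotient_map φ).trans ?_⟩
  have hφ' : (HomologicalComplex.homologyFunctor C (ComplexShape.up ℤ) i).map φ =
    (HomologicalComplex.homologyFunctorSingleIso C (ComplexShape.up ℤ) i).hom.app Q ≫
      ψ ≫ (HomotopyCategory.homologyFunctorFactors C (ComplexShape.up ℤ) i).hom.app K := hφ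
  rw [hφ', Category.assoc, Category.assoc, Iso.inv_hom_id_app_assoc, Iso.hom_inv_id_app]
  exact Category.comp_id _

end SingleHomology

/-! ### Vanishing of maps out of the third object of a triangle -/

section Triangle

variable {C : Type*} [Category* C] [Preadditive C] [HasZeroObject C] [HasShift C ℤ]
  [∀ n : ℤ, (shiftFunctor C n).Additive] [Pretriangulated C]

/-- There are no nonzero morphisms from the third object of a distinguished triangle to `X⟦1⟧` if
and only if composition with the first morphism of the triangle is injective on morphisms to
`X⟦1⟧` and surjective on morphisms to `X`. -/
lemma forall_obj₃_eq_zero_iff {Δ : Triangle C} (hΔ : Δ ∈ distTriang C) (X : C) :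
    (∀ f : Δ.obj₃ ⟶ X⟦(1 : ℤ)⟧, f = 0) ↔
      (∀ g : Δ.obj₂ ⟶ X⟦(1 : ℤ)⟧, Δ.mor₁ ≫ g = 0 → g = 0) ∧
        ∀ f : Δ.obj₁ ⟶ X, ∃ g : Δ.obj₂ ⟶ X, Δ.mor₁ ≫ g = f := by
  constructor
  · intro h
    refine ⟨fun g hg => ?_, fun f => ?_⟩
    · obtain ⟨k, rfl⟩ := Triangle.yoneda_exact₂ Δ hΔ g hg
      rw [h k, comp_zero]
    · obtain ⟨k, hk⟩ := Triangle.yoneda_exact₃ Δ.rotate (rot_of_distTriang _ hΔ)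
        (f⟦(1 : ℤ)⟧') (h _)
      obtain ⟨k, rfl⟩ := (shiftFunctor C (1 : ℤ)).map_surjective (X := Δ.obj₂) (Y := X) k
      -- The sign is that of the last morphism of the rotated triangle.
      refine ⟨-k, (shiftFunctor C (1 : ℤ)).map_injective ?_⟩
      rw [hk, Functor.map_comp, Functor.map_neg]
      exact (Preadditive.comp_neg _ _).trans (Preadditive.neg_comp _ _).symm
  · rintro ⟨h₁, h₂⟩ f
    obtain ⟨k, rfl⟩ := Triangle.yoneda_exact₃ Δ hΔ f (h₁ _ (by
      rw [comp_distTriang_mor_zero₁₂_assoc _ hΔ, zero_comp]))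
    obtain ⟨k, rfl⟩ := (shiftFunctor C (1 : ℤ)).map_surjective k
    obtain ⟨g, rfl⟩ := h₂ k
    rw [Functor.map_comp, comp_distTriang_mor_zero₃₁_assoc _ hΔ, zero_comp]

end Triangle

/-! ### Maps out of the cone in terms of homology -/

section Dictionary

variable {C : Type*} [Category* C] [Abelian C]

/-- The isomorphism `Hᵃ(X⟦n⟧) ≅ Hᵇ(X)` for `n + a = b`. -/
def homologyShiftIso (X : HomotopyCategory C (ComplexShape.up ℤ)) (n a b : ℤ) (h : n + a = b) :
    (HomotopyCategory.homologyFunctor C (ComplexShape.up ℤ) a).obj (X⟦n⟧) ≅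
      (HomotopyCategory.homologyFunctor C (ComplexShape.up ℤ) b).obj X :=
  ((HomotopyCategory.homologyFunctor C (ComplexShape.up ℤ) 0).shiftIso n a b h).app X

variable {P₁ P₀ : C} (d : P₁ ⟶ P₀)

/-- The triangle of the mapping cone of `d`, in the homotopy category. -/
def coneTriangle : Triangle (HomotopyCategory C (ComplexShape.up ℤ)) :=
  CochainComplex.mappingCone.triangleh ((CochainComplex.singleFunctor C 0).map d)

lemma coneTriangle_distinguished : coneTriangle d ∈ distTriang _ :=
  HomotopyCategory.mappingCone_triangleh_distinguished _

lemma homologyEval_zero {Q : C} {i : ℤ} {X : HomotopyCategory C (ComplexShape.up ℤ)} :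
    homologyEval (0 : (HomotopyCategory.singleFunctor C i).obj Q ⟶ X) = 0 := by
  rw [homologyEval, Functor.map_zero, comp_zero]

variable {d} in
lemma forall_eq_zero_congr {M N : C} (e : M ≅ N) :
    (∀ g : P₀ ⟶ M, d ≫ g = 0 → g = 0) ↔ ∀ g : P₀ ⟶ N, d ≫ g = 0 → g = 0 := by
  constructor
  · intro h g hg
    have := h (g ≫ e.inv) (by rw [← Category.assoc, hg, zero_comp])
    rw [← cancel_mono e.inv, this, zero_comp]
  · intro h g hg
    have := h (g ≫ e.hom) (by rw [← Category.assoc, hg, zero_comp])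
    rw [← cancel_mono e.hom, this, zero_comp]

lemma forall_exists_comp_congr {D : Type*} [Category* D] {P₁ P₀ : D} {d : P₁ ⟶ P₀} {M N : D} (e : M ≅ N) :
    (∀ f : P₁ ⟶ M, ∃ g, d ≫ g = f) ↔ ∀ f : P₁ ⟶ N, ∃ g, d ≫ g = f := by
  constructor
  · intro h f
    obtain ⟨g, hg⟩ := h (f ≫ e.inv)
    exact ⟨g ≫ e.hom, by rw [← Category.assoc, hg, Category.assoc, e.inv_hom_id,
      Category.comp_id]⟩
  · intro h f
    obtain ⟨g, hg⟩ := h (f ≫ e.hom)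
    exact ⟨g ≫ e.inv, by rw [← Category.assoc, hg, Category.assoc, e.hom_inv_id,
      Category.comp_id]⟩

/-- The homology of a complex is the homology of its image in the homotopy category. -/
def quotientHomologyIso (K : CochainComplex C ℤ) (n : ℤ) :
    (HomotopyCategory.homologyFunctor C (ComplexShape.up ℤ) n).obj
      ((HomotopyCategory.quotient _ _).obj K) ≅ K.homology n :=
  (HomotopyCategory.homologyFunctorFactors C (ComplexShape.up ℤ) n).app K

lemma isZero_homology_single (M : C) {i n : ℤ} (h : n ≠ i) :
    IsZero ((HomotopyCategory.homologyFunctor C (ComplexShape.up ℤ) n).obj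
      ((HomotopyCategory.singleFunctor C i).obj M)) :=
  (HomologicalComplex.isZero_single_obj_homology (ComplexShape.up ℤ) i M n h).of_iso
    (quotientHomologyIso ((HomologicalComplex.single C (ComplexShape.up ℤ) i).obj M) n)

lemma isZero_homology_cone {n : ℤ} (h₀ : n ≠ 0) (h₁ : n ≠ -1) :
    IsZero ((HomotopyCategory.homologyFunctor C (ComplexShape.up ℤ) n).obj
      (coneTriangle d).obj₃) :=
  ShortComplex.Exact.isZero_of_both_zeros
    ((HomotopyCategory.homologyFunctor C (ComplexShape.up ℤ) 0).homologySequence_exact₃ _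
      (coneTriangle_distinguished d) n (n + 1) rfl)
    ((isZero_homology_single P₀ h₀).eq_of_src _ _)
    ((isZero_homology_single P₁ (i := 0) (by lia)).eq_of_tgt _ _)

/-- The morphism `P₀ ⟶ H⁰(T)` for the mapping cone `T` of `d : P₁ ⟶ P₀`. -/
def toHomologyCone :
    P₀ ⟶ (HomotopyCategory.homologyFunctor C (ComplexShape.up ℤ) 0).obj (coneTriangle d).obj₃ :=
  homologyEval (coneTriangle d).mor₂

/-- The morphism `H⁻¹(T) ⟶ P₁` for the mapping cone `T` of `d : P₁ ⟶ P₀`. -/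
def fromHomologyCone :
    (HomotopyCategory.homologyFunctor C (ComplexShape.up ℤ) (-1)).obj (coneTriangle d).obj₃ ⟶ P₁ :=
  (HomotopyCategory.homologyFunctor C (ComplexShape.up ℤ) 0).homologySequenceδ
    (coneTriangle d) (-1) 0 (by lia) ≫ (singleCompHomologyIso C 0).hom.app P₁

/-- The long exact homology sequence, with H¹ of P₁ zero: H⁰ of the cone is the cokernel of d. -/
lemma toHomologyCone_exact :
    ∃ h : d ≫ toHomologyCone d = 0, (ShortComplex.mk _ _ h).Exact ∧ Epi (toHomologyCone d) := by
  have hex := (HomotopyCategory.homologyFunctor C (ComplexShape.up ℤ) 0).homologySequence_exact₂ _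
      (coneTriangle_distinguished d) 0
  have hex' := (HomotopyCategory.homologyFunctor C (ComplexShape.up ℤ) 0).homologySequence_exact₃ _
      (coneTriangle_distinguished d) 0 1 rfl
  have h0 : d ≫ toHomologyCone d = 0 :=
    (homologyEval_precomp d _).symm.trans ((congrArg homologyEval
      (comp_distTriang_mor_zero₁₂ _ (coneTriangle_distinguished d))).trans homologyEval_zero)
  have hepi : Epi ((HomotopyCategory.homologyFunctor C (ComplexShape.up ℤ) 0).map
      (coneTriangle d).mor₂) :=
    hex'.epi_f ((isZero_homology_single P₁ (i := 0) (n := 1) (by lia)).eq_of_tgt _ _)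
  refine ⟨h0, ShortComplex.exact_of_iso ?_ hex, ?_⟩
  · refine ShortComplex.isoMk ((singleCompHomologyIso C 0).app P₁)
      ((singleCompHomologyIso C 0).app P₀) (Iso.refl _) ?_ ?_
    · exact ((singleCompHomologyIso C 0).hom.naturality d).symm
    · refine Eq.trans ?_ (Category.comp_id _).symm
      exact Iso.hom_inv_id_app_assoc (singleCompHomologyIso C 0) P₀ _
  · exact epi_comp' (inferInstanceAs (Epi ((singleCompHomologyIso C 0).inv.app P₀))) hepi

/-- The same sequence, with H⁻¹ of P₀ zero: H⁻¹ of the cone is the kernel of d. -/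
lemma fromHomologyCone_exact :
    ∃ h : fromHomologyCone d ≫ d = 0, (ShortComplex.mk _ _ h).Exact ∧
      Mono (fromHomologyCone d) := by
  have hex := (HomotopyCategory.homologyFunctor C (ComplexShape.up ℤ) 0).homologySequence_exact₁ _
      (coneTriangle_distinguished d) (-1) 0 (by lia)
  have hex' := (HomotopyCategory.homologyFunctor C (ComplexShape.up ℤ) 0).homologySequence_exact₃ _
      (coneTriangle_distinguished d) (-1) 0 (by lia)
  have hnat := (singleCompHomologyIso C 0).hom.naturality d
  have h0 : fromHomologyCone d ≫ d = 0 := by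
    refine (Category.assoc _ _ _).trans ((congrArg (_ ≫ ·) hnat.symm).trans
      ((Category.assoc _ _ _).symm.trans ?_))
    refine (congrArg (· ≫ _)
      ((HomotopyCategory.homologyFunctor C (ComplexShape.up ℤ) 0).homologySequenceδ_comp _
        (coneTriangle_distinguished d) (-1) 0 (by lia))).trans zero_comp
  have hmono : Mono ((HomotopyCategory.homologyFunctor C (ComplexShape.up ℤ) 0).homologySequenceδ
      (coneTriangle d) (-1) 0 (by lia)) :=
    hex'.mono_g ((isZero_homology_single P₀ (i := 0) (n := -1) (by lia)).eq_of_src _ _)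
  refine ⟨h0, ShortComplex.exact_of_iso ?_ hex, ?_⟩
  · refine ShortComplex.isoMk (Iso.refl _) ((singleCompHomologyIso C 0).app P₁)
      ((singleCompHomologyIso C 0).app P₀) ?_ ?_
    · exact Category.id_comp _
    · exact hnat.symm
  · exact mono_comp' hmono (inferInstanceAs (Mono ((singleCompHomologyIso C 0).hom.app P₁)))

variable [Projective P₁] [Projective P₀]

lemma forall_comp_single_map_iff (X : HomotopyCategory C (ComplexShape.up ℤ)) :
    (∀ f : (HomotopyCategory.singleFunctor C 0).obj P₁ ⟶ X,
      ∃ g, (HomotopyCategory.singleFunctor C 0).map d ≫ g = f) ↔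
    ∀ f : P₁ ⟶ (HomotopyCategory.homologyFunctor C (ComplexShape.up ℤ) 0).obj X,
      ∃ g, d ≫ g = f := by
  constructor
  · intro h f
    obtain ⟨f, rfl⟩ := homologyEval_surjective f
    obtain ⟨g, rfl⟩ := h f
    exact ⟨homologyEval g, (homologyEval_precomp d g).symm⟩
  · intro h f
    obtain ⟨g, hg⟩ := h (homologyEval f)
    obtain ⟨g, rfl⟩ := homologyEval_surjective g
    exact ⟨g, homologyEval_injective ((homologyEval_precomp d g).trans hg)⟩

lemma forall_eq_zero_of_single_map_comp_iff (X : HomotopyCategory C (ComplexShape.up ℤ)) :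
    (∀ g : (HomotopyCategory.singleFunctor C 0).obj P₀ ⟶ X,
      (HomotopyCategory.singleFunctor C 0).map d ≫ g = 0 → g = 0) ↔
    ∀ g : P₀ ⟶ (HomotopyCategory.homologyFunctor C (ComplexShape.up ℤ) 0).obj X,
      d ≫ g = 0 → g = 0 := by
  constructor
  · intro h g hg
    obtain ⟨g, rfl⟩ := homologyEval_surjective g
    rw [← homologyEval_precomp, ← homologyEval_zero] at hg
    rw [h g (homologyEval_injective hg), homologyEval_zero]
  · intro h g hg
    apply homologyEval_injective
    rw [homologyEval_zero]
    apply h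
    rw [← homologyEval_precomp, hg, homologyEval_zero]

/-- Vanishing of morphisms from the mapping cone of a morphism `d` of projective objects, in terms
of homology objects. -/
lemma forall_cone_eq_zero_iff (X : HomotopyCategory C (ComplexShape.up ℤ)) (m n : ℤ)
    (h : m + 1 = n) :
    (∀ f : (coneTriangle d).obj₃ ⟶ X⟦n⟧, f = 0) ↔
      (∀ g : P₀ ⟶ (HomotopyCategory.homologyFunctor C (ComplexShape.up ℤ) n).obj X,
        d ≫ g = 0 → g = 0) ∧
      ∀ f : P₁ ⟶ (HomotopyCategory.homologyFunctor C (ComplexShape.up ℤ) m).obj X,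
        ∃ g, d ≫ g = f := by
  have e : (X⟦m⟧)⟦(1 : ℤ)⟧ ≅ X⟦n⟧ := (shiftFunctorAdd' _ m 1 n h).symm.app X
  have h₁ : (∀ f : (coneTriangle d).obj₃ ⟶ X⟦n⟧, f = 0) ↔
      ∀ f : (coneTriangle d).obj₃ ⟶ (X⟦m⟧)⟦(1 : ℤ)⟧, f = 0 := by
    constructor
    · intro h f
      rw [← cancel_mono e.hom, h (f ≫ e.hom), zero_comp]
    · intro h f
      rw [← cancel_mono e.inv, h (f ≫ e.inv), zero_comp]
  rw [h₁, forall_obj₃_eq_zero_iff (coneTriangle_distinguished d)]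
  refine and_congr ((forall_eq_zero_of_single_map_comp_iff d _).trans ?_)
    ((forall_comp_single_map_iff d _).trans ?_)
  · exact forall_eq_zero_congr (homologyShiftIso _ 1 0 1 (by lia) ≪≫
      homologyShiftIso X m 1 n h)
  · exact forall_exists_comp_congr (homologyShiftIso X m 0 m (by lia))

end Dictionary

/-! ### K-projectivity of the cone and passage to the derived category -/

section Cone

variable {C : Type*} [Category* C] [Abelian C]

lemma projective_single_X (M : C) [Projective M] (i n : ℤ) :
    Projective (((HomologicalComplex.single C (ComplexShape.up ℤ) i).obj M).X n) := by
  by_cases h : n = i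
  · subst h
    exact Projective.of_iso (HomologicalComplex.singleObjXSelf _ n M).symm inferInstance
  · exact (HomologicalComplex.isZero_single_obj_X (ComplexShape.up ℤ) i M n h).projective

/-- The terms of the mapping cone. -/
def mappingConeXIso {K L : CochainComplex C ℤ} (φ : K ⟶ L) (n : ℤ) :
    (CochainComplex.mappingCone φ).X n ≅ K.X (n + 1) ⊞ L.X n :=
  HomologicalComplex.homotopyCofiber.XIsoBiprod φ n (n + 1) rfl

variable {P₁ P₀ : C} (d : P₁ ⟶ P₀)

lemma isKProjective_mappingCone_single [Projective P₁] [Projective P₀] :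
    (CochainComplex.mappingCone ((CochainComplex.singleFunctor C 0).map d)).IsKProjective := by
  have h (n : ℤ) : Projective
      ((CochainComplex.mappingCone ((CochainComplex.singleFunctor C 0).map d)).X n) := by
    have := projective_single_X P₁ 0 (n + 1)
    have := projective_single_X P₀ 0 n
    exact Projective.of_iso (mappingConeXIso _ n).symm
      (inferInstanceAs (Projective (((HomologicalComplex.single C (ComplexShape.up ℤ) 0).obj P₁).X
        (n + 1) ⊞ ((HomologicalComplex.single C (ComplexShape.up ℤ) 0).obj P₀).X n)))
  have : (CochainComplex.mappingCone
      ((CochainComplex.singleFunctor C 0).map d)).IsStrictlyLE 0 := by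
    rw [CochainComplex.isStrictlyLE_iff]
    intro n hn
    refine IsZero.of_iso ?_ (mappingConeXIso _ n)
    exact (biprod_isZero_iff _ _).2
      ⟨HomologicalComplex.isZero_single_obj_X (ComplexShape.up ℤ) 0 P₁ (n + 1) (by lia),
        HomologicalComplex.isZero_single_obj_X (ComplexShape.up ℤ) 0 P₀ n (by lia)⟩
  exact CochainComplex.isKProjective_of_projective _ 0

lemma forall_derivedHom_eq_zero_iff [HasDerivedCategory.{w} C] (K : CochainComplex C ℤ)
    [K.IsKProjective] (L : HomotopyCategory C (ComplexShape.up ℤ)) {Y : DerivedCategory C}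
    (e : DerivedCategory.Qh.obj L ≅ Y) :
    (∀ f : DerivedCategory.Q.obj K ⟶ Y, f = 0) ↔
      ∀ f : (HomotopyCategory.quotient _ _).obj K ⟶ L, f = 0 := by
  have hb := CochainComplex.IsKProjective.Qh_map_bijective K L
  let a : DerivedCategory.Qh.obj ((HomotopyCategory.quotient _ _).obj K) ≅
    DerivedCategory.Q.obj K := (DerivedCategory.quotientCompQhIso C).app K
  constructor
  · intro h f
    apply hb.1
    have := h (a.inv ≫ DerivedCategory.Qh.map f ≫ e.hom)
    rw [← IsIso.eq_inv_comp, comp_zero] at this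
    rw [← IsIso.eq_comp_inv, zero_comp] at this
    rw [this, Functor.map_zero]
  · intro h f
    obtain ⟨g, hg⟩ := hb.2 (a.hom ≫ f ≫ e.inv)
    rw [h g, Functor.map_zero, eq_comm, ← IsIso.eq_inv_comp, comp_zero, ← IsIso.eq_comp_inv,
      zero_comp] at hg
    exact hg

end Cone

/-! ### The classes 𝒳_c, 𝒴_c and the self-extensions of the cone in terms of d -/

section ModuleDictionary

variable {A : Type u} [Ring A] {P₁ P₀ : ModuleCat.{u} A} (d : P₁ ⟶ P₀)

lemma extendsAlong_hom_iff (M : ModuleCat.{u} A) :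
    ExtendsAlong d.hom M ↔ ∀ f : P₁ ⟶ M, ∃ g, d ≫ g = f := by
  constructor
  · intro h f
    obtain ⟨g, hg⟩ := h f.hom
    exact ⟨ModuleCat.ofHom g, ModuleCat.hom_ext hg⟩
  · intro h f
    obtain ⟨g, hg⟩ := h (ModuleCat.ofHom f)
    exact ⟨g.hom, congrArg ModuleCat.Hom.hom hg⟩

lemma detectedAlong_hom_iff (M : ModuleCat.{u} A) :
    DetectedAlong d.hom M ↔ ∀ g : P₀ ⟶ M, d ≫ g = 0 → g = 0 := by
  constructor
  · intro h g hg
    exact ModuleCat.hom_ext (h g.hom (congrArg ModuleCat.Hom.hom hg))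
  · intro h g hg
    exact congrArg ModuleCat.Hom.hom (h (ModuleCat.ofHom g) (ModuleCat.hom_ext hg))

/-- The homology in degree `0` of the mapping cone of `d` is the cokernel of `d`. -/
def homologyConeEquivQuotient :
    ((HomotopyCategory.homologyFunctor (ModuleCat.{u} A) (ComplexShape.up ℤ) 0).obj
      (coneTriangle d).obj₃) ≃ₗ[A] P₀ ⧸ LinearMap.range d.hom :=
  ((Submodule.quotEquivOfEq _ _ ((ShortComplex.moduleCat_exact_iff_range_eq_ker _).1
      (toHomologyCone_exact d).choose_spec.1)).trans
    ((toHomologyCone d).hom.quotKerEquivOfSurjective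
      ((ModuleCat.epi_iff_surjective _).1 (toHomologyCone_exact d).choose_spec.2))).symm

/-- The homology in degree `-1` of the mapping cone of `d` is the kernel of `d`. -/
def homologyConeEquivKer :
    ((HomotopyCategory.homologyFunctor (ModuleCat.{u} A) (ComplexShape.up ℤ) (-1)).obj
      (coneTriangle d).obj₃) ≃ₗ[A] LinearMap.ker d.hom :=
  (LinearEquiv.ofInjective (fromHomologyCone d).hom
      ((ModuleCat.mono_iff_injective _).1 (fromHomologyCone_exact d).choose_spec.2)).trans
    (LinearEquiv.ofEq _ _ ((ShortComplex.moduleCat_exact_iff_range_eq_ker _).1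
      (fromHomologyCone_exact d).choose_spec.1))

/-- The homology of `twoTerm d` in degree `0`. -/
def homologyTwoTermEquivQuotient :
    (twoTerm d).homology 0 ≃ₗ[A] P₀ ⧸ LinearMap.range d.hom :=
  (quotientHomologyIso (twoTerm d) 0).toLinearEquiv.symm.trans (homologyConeEquivQuotient d)

/-- The homology of `twoTerm d` in degree `-1`. -/
def homologyTwoTermEquivKer :
    (twoTerm d).homology (-1) ≃ₗ[A] LinearMap.ker d.hom :=
  (quotientHomologyIso (twoTerm d) (-1)).toLinearEquiv.symm.trans (homologyConeEquivKer d)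

/-- A module as an object of the homotopy category. -/
abbrev stalk (M : ModuleCat.{u} A) : K A :=
  (HomotopyCategory.singleFunctor (ModuleCat.{u} A) 0).obj M

/-- The mapping cone of `d` as an object of the homotopy category. -/
abbrev cone : K A := (coneTriangle d).obj₃

variable [Module.Projective A P₁] [Module.Projective A P₀]

lemma forall_cone_stalk_shift_one_iff (M : ModuleCat.{u} A) :
    (∀ f : cone d ⟶ (stalk M)⟦(1 : ℤ)⟧, f = 0) ↔ ExtendsAlong d.hom M := by
  rw [forall_cone_eq_zero_iff d (stalk M) 0 1 (zero_add 1), extendsAlong_hom_iff]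
  exact (and_iff_right fun g _ =>
    (isZero_homology_single M (i := 0) (n := 1) (by lia)).eq_of_tgt g 0).trans
    (forall_exists_comp_congr ((singleCompHomologyIso _ 0).app M))

lemma forall_cone_stalk_shift_zero_iff (M : ModuleCat.{u} A) :
    (∀ f : cone d ⟶ (stalk M)⟦(0 : ℤ)⟧, f = 0) ↔ DetectedAlong d.hom M := by
  rw [forall_cone_eq_zero_iff d (stalk M) (-1) 0 (by lia), detectedAlong_hom_iff]
  exact (and_iff_left fun f => ⟨0,
    (isZero_homology_single M (i := 0) (n := -1) (by lia)).eq_of_tgt _ f⟩).trans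
    (forall_eq_zero_congr ((singleCompHomologyIso _ 0).app M))

section

variable [HasDerivedCategory.{w} (ModuleCat.{u} A)]

lemma classX_twoTerm_iff (M : ModuleCat.{u} A) :
    classX (twoTerm d) M ↔ ExtendsAlong d.hom M := by
  have := isKProjective_mappingCone_single d
  rw [← forall_cone_stalk_shift_one_iff]
  exact forall_derivedHom_eq_zero_iff (CochainComplex.mappingCone
    ((CochainComplex.singleFunctor (ModuleCat.{u} A) 0).map d)) _
    ((DerivedCategory.Qh.commShiftIso (1 : ℤ)).app (stalk M))

lemma classY_twoTerm_iff (M : ModuleCat.{u} A) :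
    classY (twoTerm d) M ↔ DetectedAlong d.hom M := by
  have := isKProjective_mappingCone_single d
  rw [← forall_cone_stalk_shift_zero_iff]
  exact forall_derivedHom_eq_zero_iff (CochainComplex.mappingCone
    ((CochainComplex.singleFunctor (ModuleCat.{u} A) 0).map d)) _
    (DerivedCategory.Qh.mapIso ((shiftFunctorZero (K A) ℤ).app (stalk M)))

lemma classXc_twoTerm : classXc (twoTerm d) = extendsFG d.hom := by
  ext M
  exact and_congr_left fun _ => classX_twoTerm_iff d M

lemma classYc_twoTerm : classYc (twoTerm d) = detectedFG d.hom := by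
  ext M
  exact and_congr_left fun _ => classY_twoTerm_iff d M

end

/-- Vanishing of the self-extensions of the mapping cone of `d`. -/
lemma forall_cone_shift_eq_zero_iff :
    (∀ i : ℤ, i ≠ 0 → ∀ f : cone d ⟶ (cone d)⟦i⟧, f = 0) ↔
      ExtendsAlong d.hom (P₀ ⧸ LinearMap.range d.hom) ∧
        DetectedAlong d.hom (LinearMap.ker d.hom) := by
  have h (i : ℤ) := forall_cone_eq_zero_iff d (cone d) (i - 1) i (by lia)
  rw [← ExtendsAlong.congr (homologyConeEquivQuotient d),
    ← DetectedAlong.congr (homologyConeEquivKer d), extendsAlong_hom_iff, detectedAlong_hom_iff]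
  constructor
  · intro H
    exact ⟨((h 1).1 (H 1 (by lia))).2, ((h (-1)).1 (H (-1) (by lia))).1⟩
  · rintro ⟨h₀, h₁⟩ i hi
    -- The homology of the cone sits in degrees 0 and -1. With i ≠ 0, the condition on Hⁱ is void
    -- unless i = -1, and the one on Hⁱ⁻¹ unless i = 1.
    refine (h i).2 ⟨?_, ?_⟩
    · by_cases hi' : i = -1
      · subst hi'
        exact h₁
      · exact fun g _ => (isZero_homology_cone d hi hi').eq_of_tgt g 0
    · by_cases hi' : i = 1
      · subst hi'
        exact h₀
      · exact fun f => ⟨0, (isZero_homology_cone d (n := i - 1) (by lia) (by lia)).eq_of_tgt _ f⟩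

end ModuleDictionary

lemma eq_zero_of_comp_iso {C : Type*} [Category* C] [HasZeroMorphisms C] {X Y Z : C} (e : Y ≅ Z)
    {f : X ⟶ Y} (h : f ≫ e.hom = 0) : f = 0 := by
  rw [← cancel_mono e.hom, h, zero_comp]

/-! ### Direct summands of finite sums -/

section AddClosure

variable {C : Type*} [Category* C] [Preadditive C] [HasFiniteBiproducts C]
    [HasBinaryBiproducts C]

lemma leftOrthogonal_of_addClosure {W : ObjectProperty C} {T X : C} (hT : W.leftOrthogonal T)
    (hX : addClosure T X) : W.leftOrthogonal X := by
  obtain ⟨n, Y, ⟨e⟩⟩ := hX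
  intro Z f hZ
  have h : e.inv ≫ biprod.fst ≫ f = 0 := biproduct.hom_ext' _ _ fun i =>
    (hT _ hZ).trans comp_zero.symm
  rw [← IsIso.eq_inv_comp, comp_zero] at h
  rw [← cancel_epi (biprod.fst : X ⊞ Y ⟶ X), h, comp_zero]

lemma addClosure_biproduct (T : C) (n : ℕ) : addClosure T (⨁ fun _ : Fin n => T) :=
  ⟨n, ⨁ fun _ : Fin 0 => T, ⟨(isoBiprodZero ((IsZero.iff_id_eq_zero _).2
    (biproduct.hom_ext' _ _ fun i => i.elim0))).symm⟩⟩

end AddClosure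

/-! ### Membership in K^b(proj A) -/

section Perfect

variable {A : Type u} [Ring A]

lemma finite_projective_of_isZero {M : ModuleCat.{u} A} (h : IsZero M) :
    Module.Finite A M ∧ Module.Projective A M := by
  have := ModuleCat.subsingleton_of_isZero h
  have := Module.Free.of_subsingleton A M
  exact ⟨inferInstance, Module.Projective.of_free⟩

lemma finite_projective_of_iso {M N : ModuleCat.{u} A} (e : M ≅ N)
    (h : Module.Finite A M ∧ Module.Projective A M) :
    Module.Finite A N ∧ Module.Projective A N :=
  have := h.1
  have := h.2
  ⟨Module.Finite.equiv e.toLinearEquiv, Module.Projective.of_equiv e.toLinearEquiv⟩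

lemma finite_projective_biprod {M N : ModuleCat.{u} A}
    (hM : Module.Finite A M ∧ Module.Projective A M)
    (hN : Module.Finite A N ∧ Module.Projective A N) :
    Module.Finite A (M ⊞ N : ModuleCat.{u} A) ∧ Module.Projective A (M ⊞ N : ModuleCat.{u} A) := by
  have := hM.1
  have := hM.2
  have := hN.1
  have := hN.2
  exact finite_projective_of_iso (ModuleCat.biprodIsoProd M N).symm ⟨inferInstance, inferInstance⟩

lemma finite_projective_single_X (M : ModuleCat.{u} A)
    (h : Module.Finite A M ∧ Module.Projective A M) (i n : ℤ) :
    Module.Finite A (((HomologicalComplex.single _ (ComplexShape.up ℤ) i).obj M).X n) ∧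
      Module.Projective A (((HomologicalComplex.single _ (ComplexShape.up ℤ) i).obj M).X n) := by
  by_cases hn : n = i
  · subst hn
    exact finite_projective_of_iso (HomologicalComplex.singleObjXSelf _ n M).symm h
  · exact finite_projective_of_isZero
      (HomologicalComplex.isZero_single_obj_X (ComplexShape.up ℤ) i M n hn)

lemma kbProj_stalk (M : ModuleCat.{u} A) [Module.Finite A M] [Module.Projective A M] :
    KbProj A (stalk M) :=
  ⟨(HomologicalComplex.single _ (ComplexShape.up ℤ) 0).obj M,
    fun n => finite_projective_single_X M ⟨inferInstance, inferInstance⟩ 0 n,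
    ⟨0, 0, fun n hn => HomologicalComplex.isZero_single_obj_X (ComplexShape.up ℤ) 0 M n
      (by lia)⟩, ⟨Iso.refl _⟩⟩

variable {P₁ P₀ : ModuleCat.{u} A} (d : P₁ ⟶ P₀)

lemma kbProj_cone [Module.Finite A P₁] [Module.Projective A P₁] [Module.Finite A P₀]
    [Module.Projective A P₀] : KbProj A (cone d) := by
  refine ⟨CochainComplex.mappingCone ((CochainComplex.singleFunctor (ModuleCat.{u} A) 0).map d),
    fun n => ?_, ⟨-1, 0, fun n hn => ?_⟩, ⟨Iso.refl _⟩⟩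
  · exact finite_projective_of_iso (mappingConeXIso _ n).symm (finite_projective_biprod
      (finite_projective_single_X P₁ ⟨inferInstance, inferInstance⟩ 0 (n + 1))
      (finite_projective_single_X P₀ ⟨inferInstance, inferInstance⟩ 0 n))
  · refine IsZero.of_iso ?_ (mappingConeXIso _ n)
    exact (biprod_isZero_iff _ _).2
      ⟨HomologicalComplex.isZero_single_obj_X (ComplexShape.up ℤ) 0 P₁ (n + 1) (by lia),
        HomologicalComplex.isZero_single_obj_X (ComplexShape.up ℤ) 0 P₀ n (by lia)⟩

end Perfect

/-! ### A tilting cone forces 𝒳_c and 𝒴_c to meet in zero -/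

section TiltingMeet

variable {A : Type u} [Ring A]

/-- The shifts of an object. -/
def shifts {C : Type*} [Category* C] [HasShift C ℤ] (X : C) : ObjectProperty C :=
  fun Y => ∃ i : ℤ, Nonempty (Y ≅ X⟦i⟧)

instance {C : Type*} [Category* C] [HasShift C ℤ] (X : C) : (shifts X).IsStableUnderShift ℤ where
  isStableUnderShiftBy a := ⟨by
    rintro Y ⟨i, ⟨e⟩⟩
    exact ⟨i + a, ⟨(shiftFunctor C a).mapIso e ≪≫ (shiftFunctorAdd C i a).symm.app X⟩⟩⟩

variable {P₁ P₀ : ModuleCat.{u} A} (d : P₁ ⟶ P₀) [Module.Projective A P₁] [Module.Projective A P₀]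

lemma forall_cone_shifts_eq_zero {M : ModuleCat.{u} A} (h₁ : ExtendsAlong d.hom M)
    (h₀ : DetectedAlong d.hom M) : (shifts (stalk M)).leftOrthogonal (cone d) := by
  rintro Y f ⟨i, ⟨e⟩⟩
  suffices h : ∀ f : cone d ⟶ (stalk M)⟦i⟧, f = 0 by
    rw [← cancel_mono e.hom, h (f ≫ e.hom), zero_comp]
  by_cases hi₀ : i = 0
  · subst hi₀
    exact (forall_cone_stalk_shift_zero_iff d M).2 h₀
  by_cases hi₁ : i = 1
  · subst hi₁
    exact (forall_cone_stalk_shift_one_iff d M).2 h₁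
  · exact (forall_cone_eq_zero_iff d (stalk M) (i - 1) i (by lia)).2
      ⟨fun g _ => (isZero_homology_single M hi₀).eq_of_tgt g 0,
        fun f => ⟨0, (isZero_homology_single M (i := 0) (n := i - 1) (by lia)).eq_of_tgt _ f⟩⟩

/-- The objects without maps to any shift of M form a triangulated subcategory. It contains the
cone, hence A, and maps A → M are the elements of M. -/
lemma IsTilting.subsingleton_of_extendsAlong_of_detectedAlong (h : IsTilting (cone d))
    {M : ModuleCat.{u} A} (h₁ : ExtendsAlong d.hom M)
    (h₀ : DetectedAlong d.hom M) : Subsingleton M := by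
  have hS := h.generates (shifts (stalk M)).leftOrthogonal inferInstance inferInstance
    (fun X hX => leftOrthogonal_of_addClosure (forall_cone_shifts_eq_zero d h₁ h₀) hX)
    (stalk (ModuleCat.of A A)) (kbProj_stalk _)
  have hM : ∀ f : ModuleCat.of A A ⟶ M, f = 0 := fun f => by
    obtain ⟨g, hg⟩ := homologyEval_surjective (X := stalk M) (i := 0)
      (f ≫ (singleCompHomologyIso (ModuleCat.{u} A) 0).inv.app M)
    have h0 : f ≫ (singleCompHomologyIso (ModuleCat.{u} A) 0).inv.app M = 0 :=
      hg.symm.trans ((congrArg homologyEval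
        (hS g ⟨0, ⟨(shiftFunctorZero (K A) ℤ).symm.app _⟩⟩)).trans homologyEval_zero)
    exact eq_zero_of_comp_iso ((singleCompHomologyIso (ModuleCat.{u} A) 0).symm.app M) h0
  refine subsingleton_of_forall_eq 0 fun m => ?_
  have := LinearMap.congr_fun (congrArg ModuleCat.Hom.hom
    (hM (ModuleCat.ofHom (LinearMap.toSpanSingleton A M m)))) (1 : A)
  simpa using this

end TiltingMeet

/-! ### Bounded complexes are built from their terms -/

section Bounded

variable {C : Type*} [Category* C] [Abelian C]

/-- The inclusion of the last term of a complex. -/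
def fromSingleTop (L : CochainComplex C ℤ) (b : ℤ) (hb : IsZero (L.X (b + 1))) :
    (HomologicalComplex.single C (ComplexShape.up ℤ) b).obj (L.X b) ⟶ L :=
  HomologicalComplex.mkHomFromSingle (𝟙 _) fun k hk => by
    obtain rfl : b + 1 = k := hk
    exact hb.eq_of_tgt _ _

variable (L : CochainComplex C ℤ) (b : ℤ) (hb : IsZero (L.X (b + 1)))

lemma isIso_fromSingleTop_f : IsIso ((fromSingleTop L b hb).f b) := by
  rw [fromSingleTop, HomologicalComplex.mkHomFromSingle_f, Category.comp_id]
  infer_instance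

lemma mono_fromSingleTop_f (n : ℤ) : Mono ((fromSingleTop L b hb).f n) := by
  by_cases h : n = b
  · subst h
    have := isIso_fromSingleTop_f L n hb
    infer_instance
  · exact (HomologicalComplex.isZero_single_obj_X (ComplexShape.up ℤ) b (L.X b) n h).mono _

/-- The short exact sequence of complexes given by the last term of a complex. -/
def topShortComplex : ShortComplex (CochainComplex C ℤ) :=
  ShortComplex.mk (fromSingleTop L b hb) (cokernel.π _) (cokernel.condition _)

lemma topShortComplex_shortExact : (topShortComplex L b hb).ShortExact := by
  have (n : ℤ) := mono_fromSingleTop_f L b hb n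
  have : Mono (fromSingleTop L b hb) := HomologicalComplex.mono_of_mono_f _ inferInstance
  exact
    { exact := ShortComplex.exact_cokernel _
      mono_f := this
      epi_g := coequalizer.π_epi }

lemma topShortComplex_map_shortExact (n : ℤ) :
    ((topShortComplex L b hb).map (HomologicalComplex.eval C _ n)).ShortExact :=
  (topShortComplex_shortExact L b hb).map_of_exact _

lemma isZero_topShortComplex_X₃ : IsZero ((topShortComplex L b hb).X₃.X b) := by
  have hepi : Epi ((topShortComplex L b hb).g.f b) := (topShortComplex_map_shortExact L b hb b).epi_g
  have hiso : IsIso ((topShortComplex L b hb).f.f b) := isIso_fromSingleTop_f L b hb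
  refine IsZero.of_epi_eq_zero ((topShortComplex L b hb).g.f b) ?_
  rw [← cancel_epi ((topShortComplex L b hb).f.f b), comp_zero, ← HomologicalComplex.comp_f,
    (topShortComplex L b hb).zero]
  rfl

lemma nonempty_iso_topShortComplex_X₃ {n : ℤ} (h : n ≠ b) :
    Nonempty (L.X n ≅ (topShortComplex L b hb).X₃.X n) := by
  have hS := topShortComplex_map_shortExact L b hb n
  have hg : IsIso ((topShortComplex L b hb).g.f n) := (hS.isIso_g_iff).2
    (HomologicalComplex.isZero_single_obj_X (ComplexShape.up ℤ) b (L.X b) n h)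
  exact ⟨@asIso _ _ _ _ ((topShortComplex L b hb).g.f n) hg⟩

variable (Z : ObjectProperty C) [Z.IsClosedUnderIsomorphisms] [Z.ContainsZero]
  (S : ObjectProperty (HomotopyCategory C (ComplexShape.up ℤ))) [S.IsTriangulated]
  [S.IsClosedUnderIsomorphisms]

/-- A triangulated subcategory of the homotopy category which contains the objects of `Z`, placed
in any degree, contains the bounded complexes with terms in `Z`, for a class `Z` of projective
objects. -/
lemma prop_quotient_of_bounded (hZ : ∀ M, Z M → Projective M)
    (hS : ∀ (M : C) (n : ℤ), Z M → S ((HomotopyCategory.quotient _ _).obj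
      ((HomologicalComplex.single C (ComplexShape.up ℤ) n).obj M)))
    (k : ℕ) : ∀ (b : ℤ) (L : CochainComplex C ℤ), (∀ n, Z (L.X n)) →
      (∀ n : ℤ, (n ≤ b - k ∨ b < n) → IsZero (L.X n)) →
      S ((HomotopyCategory.quotient _ _).obj L) := by
  -- Here k counts the degrees n with b - k < n ≤ b; each step strips off the term in degree b.
  induction k with
  | zero =>
    intro b L _ h
    have hL : IsZero L := (IsZero.iff_id_eq_zero _).2
      (HomologicalComplex.hom_ext _ _ fun n => (h n (by lia)).eq_of_src _ _)
    exact S.prop_of_isZero ((HomotopyCategory.quotient _ _).map_isZero hL)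
  | succ k ih =>
    intro b L hL h
    have hb : IsZero (L.X (b + 1)) := h _ (by lia)
    have hX₃ (n : ℤ) : Z ((topShortComplex L b hb).X₃.X n) := by
      by_cases hn : n = b
      · subst hn
        exact Z.prop_of_isZero (isZero_topShortComplex_X₃ L n hb)
      · exact Z.prop_of_iso (nonempty_iso_topShortComplex_X₃ L b hb hn).some (hL n)
    have h₃ := ih (b - 1) (topShortComplex L b hb).X₃ hX₃ fun n hn => by
      by_cases hn' : n = b
      · subst hn'
        exact isZero_topShortComplex_X₃ L n hb
      · exact (h n (by lia)).of_iso (nonempty_iso_topShortComplex_X₃ L b hb hn').some.symm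
    -- Projective quotient terms split the sequence degreewise, so it gives a distinguished triangle
    -- in the homotopy category.
    have (n : ℤ) : Projective ((topShortComplex L b hb).map
      (HomologicalComplex.eval C (ComplexShape.up ℤ) n)).X₃ := hZ _ (hX₃ n)
    have hT := (HomotopyCategory.distinguished_iff_iso_trianglehOfDegreewiseSplit _).2
      ⟨topShortComplex L b hb,
        fun n => (topShortComplex_map_shortExact L b hb n).splittingOfProjective, ⟨Iso.refl _⟩⟩
    exact S.ext_of_isTriangulatedClosed₂ _ hT (hS _ _ (hL b)) h₃

end Bounded

/-! ### Generation by approximation -/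

section Approximation

variable {C : Type*} [Category* C] [Preadditive C] [HasFiniteBiproducts C]

/-- A morphism `φ : Tⁿ ⟶ X` through which all morphisms `T ⟶ X` factor exists if
the morphisms `T ⟶ X` form a finitely generated module. -/
lemma exists_right_approximation (R : Type*) [CommRing R] [Linear R C] (T X : C)
    [Module.Finite R (T ⟶ X)] :
    ∃ (n : ℕ) (φ : (⨁ fun _ : Fin n => T) ⟶ X), ∀ f : T ⟶ X, ∃ g, g ≫ φ = f := by
  obtain ⟨n, s, hs⟩ := Module.Finite.exists_fin (R := R) (M := T ⟶ X)
  refine ⟨n, biproduct.desc s, fun f => ?_⟩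
  obtain ⟨c, rfl⟩ := (Submodule.mem_span_range_iff_exists_fun R).1
    (hs.symm ▸ Submodule.mem_top : f ∈ Submodule.span R (Set.range s))
  refine ⟨biproduct.lift fun i => c i • 𝟙 T, ?_⟩
  rw [biproduct.lift_desc]
  exact Finset.sum_congr rfl fun i _ => (Linear.smul_comp _ _ _ _ _ _).trans
    (congrArg _ (Category.id_comp _))

variable [HasShift C ℤ] [∀ n : ℤ, (shiftFunctor C n).Additive]

lemma eq_zero_of_forall_shift_eq_zero {T X : C} {a : ℤ} (h : ∀ f : X ⟶ T⟦a⟧, f = 0) {n : ℕ}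
    (f : X ⟶ (⨁ fun _ : Fin n => T)⟦a⟧) : f = 0 := by
  have h1 : f = f ≫ (shiftFunctor C a).map (𝟙 _) := by
    rw [CategoryTheory.Functor.map_id, Category.comp_id]
  rw [h1, ← biproduct.total, Functor.map_sum, Preadditive.comp_sum]
  refine Finset.sum_eq_zero fun i _ => ?_
  rw [Functor.map_comp, ← Category.assoc, h (f ≫ _), zero_comp]

variable [HasZeroObject C] [Pretriangulated C]

/-- The rotated triangle G[-1] → Tⁿ → E splits, so E is a summand of Tⁿ. -/
lemma addClosure_of_distTriang_of_mor₂_eq_zero {T : C} {n : ℕ} {E G : C}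
    {ψ : (⨁ fun _ : Fin n => T) ⟶ E} {v : E ⟶ G} {w : G ⟶ (⨁ fun _ : Fin n => T)⟦(1 : ℤ)⟧}
    (hT : Triangle.mk ψ v w ∈ distTriang C) (hv : v = 0) : addClosure T E := by
  obtain ⟨e, -⟩ := exists_iso_binaryBiproduct_of_distTriang _ (inv_rot_of_distTriang _ hT)
    ((congrArg (· ≫ _) hv).trans zero_comp)
  exact ⟨n, _, ⟨biprod.braiding _ _ ≪≫ e.symm⟩⟩

/-- A criterion for an object `Y` to belong to the triangulated subcategory generated by the
direct summands of the finite direct sums of copies of `T`. -/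
lemma prop_of_addClosure_le (R : Type*) [CommRing R] [Linear R C] {T Y : C}
    {F S : ObjectProperty C} [F.IsTriangulated] [F.IsClosedUnderIsomorphisms]
    [S.IsTriangulated] [S.IsClosedUnderIsomorphisms] (hS : addClosure T ≤ S)
    (hF : ∀ X, F X → Module.Finite R (T ⟶ X))
    (hFT : ∀ n, F (⨁ fun _ : Fin n => T)) (hFY : F Y)
    (h₁ : ∀ f : T ⟶ T⟦(1 : ℤ)⟧, f = 0) (h₂ : ∀ f : T ⟶ T⟦(2 : ℤ)⟧, f = 0)
    (hG : ∀ G, F G → (∀ f : T ⟶ G, f = 0) → (∀ f : T ⟶ G⟦(1 : ℤ)⟧, f = 0) → ∀ f : Y ⟶ G, f = 0) :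
    S Y := by
  have h₂' {n : ℕ} (f : T ⟶ ((⨁ fun _ : Fin n => T)⟦(1 : ℤ)⟧)⟦(1 : ℤ)⟧) : f = 0 :=
    eq_zero_of_comp_iso ((shiftFunctorAdd' C (1 : ℤ) 1 2 rfl).symm.app _)
      (eq_zero_of_forall_shift_eq_zero h₂ _)
  have := hF _ (F.le_shift (1 : ℤ) _ hFY)
  -- The universal extension Y → E → Tⁿ → Y[1]: every map T → Y[1] factors through φ, which forces
  -- Hom(T, E[1]) = 0.
  obtain ⟨n, φ, hφ⟩ := exists_right_approximation R T (Y⟦(1 : ℤ)⟧)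
  obtain ⟨E, u, v, hE⟩ := distinguished_cocone_triangle₂ φ
  have hFE : F E := F.ext_of_isTriangulatedClosed₂ _ hE hFY (hFT n)
  have hE₁ (f : T ⟶ E⟦(1 : ℤ)⟧) : f = 0 := by
    obtain ⟨g, rfl⟩ := Triangle.coyoneda_exact₁ _ (rot_of_distTriang _ hE) f
      (eq_zero_of_forall_shift_eq_zero h₁ _)
    obtain ⟨g, rfl⟩ := hφ g
    refine (Preadditive.comp_neg _ _).trans (neg_eq_zero.2 ((Category.assoc _ _ _).trans ?_))
    exact (congrArg (g ≫ ·) (comp_distTriang_mor_zero₃₁ _ hE)).trans comp_zero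
  have := hF _ hFE
  -- The cone G of an approximation Tᵐ → E has no maps from T to G or G[1], so `hG` kills Y → G.
  -- Then E → G factors through Tⁿ and is zero, which makes E a summand of Tᵐ.
  obtain ⟨m, ψ, hψ⟩ := exists_right_approximation R T E
  obtain ⟨G, p, q, hGT⟩ := distinguished_cocone_triangle ψ
  have hFG : F G := F.ext_of_isTriangulatedClosed₃ _ hGT (hFT m) hFE
  have hG₀ (f : T ⟶ G) : f = 0 := by
    obtain ⟨g, rfl⟩ := Triangle.coyoneda_exact₃ _ hGT f (eq_zero_of_forall_shift_eq_zero h₁ _)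
    obtain ⟨g, rfl⟩ := hψ g
    exact (Category.assoc _ _ _).trans
      ((congrArg (g ≫ ·) (comp_distTriang_mor_zero₁₂ _ hGT)).trans comp_zero)
  have hG₁ (f : T ⟶ G⟦(1 : ℤ)⟧) : f = 0 := by
    obtain ⟨g, rfl⟩ := Triangle.coyoneda_exact₁ _
      (rot_of_distTriang _ (rot_of_distTriang _ hGT)) f (h₂' _)
    exact (congrArg (· ≫ _) (hE₁ g)).trans zero_comp
  have hEG (f : E ⟶ G) : f = 0 := by
    obtain ⟨g, rfl⟩ := Triangle.yoneda_exact₂ _ hE f (hG G hFG hG₀ hG₁ _)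
    have : g = 0 := biproduct.hom_ext' _ _ fun i => (hG₀ _).trans comp_zero.symm
    exact (congrArg (_ ≫ ·) this).trans comp_zero
  exact S.ext_of_isTriangulatedClosed₁ _ hE
    (hS _ (addClosure_of_distTriang_of_mor₂_eq_zero hGT (hEG p))) (hS _ (addClosure_biproduct T n))

end Approximation

/-! ### Finiteness of Hom out of the cone -/

section Linear

variable {C : Type*} [Category* C] [Abelian C] {R : Type*} [CommRing R] [Linear R C]

lemma singleFunctor_map_smul {Q Q' : C} (i : ℤ) (r : R) (f : Q ⟶ Q') :
    (HomotopyCategory.singleFunctor C i).map (r • f) =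
      r • (HomotopyCategory.singleFunctor C i).map f := by
  have h : (HomologicalComplex.single C (ComplexShape.up ℤ) i).map (r • f) =
      r • (HomologicalComplex.single C (ComplexShape.up ℤ) i).map f := by
    refine HomologicalComplex.from_single_hom_ext ?_
    rw [HomologicalComplex.smul_f_apply, HomologicalComplex.single_map_f_self,
      HomologicalComplex.single_map_f_self, Linear.smul_comp, Linear.comp_smul]
  exact (congrArg (HomotopyCategory.quotient C (ComplexShape.up ℤ)).map h).trans
    ((HomotopyCategory.quotient C (ComplexShape.up ℤ)).map_smul r
      ((HomologicalComplex.single C (ComplexShape.up ℤ) i).map f))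

lemma homologyEval_smul {Q : C} {i : ℤ} {X : HomotopyCategory C (ComplexShape.up ℤ)} (r : R)
    (f : (HomotopyCategory.singleFunctor C i).obj Q ⟶ X) :
    homologyEval (r • f) = r • homologyEval f := by
  have h1 : r • f = (HomotopyCategory.singleFunctor C i).map (r • 𝟙 Q) ≫ f := by
    rw [singleFunctor_map_smul, CategoryTheory.Functor.map_id, Linear.smul_comp, Category.id_comp]
  rw [h1, homologyEval_precomp, Linear.smul_comp, Category.id_comp]

variable (R) in
lemma isNoetherian_single_hom (Q : C) [Projective Q] (i : ℤ)
    (X : HomotopyCategory C (ComplexShape.up ℤ))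
    [IsNoetherian R (Q ⟶ (HomotopyCategory.homologyFunctor C (ComplexShape.up ℤ) i).obj X)] :
    IsNoetherian R ((HomotopyCategory.singleFunctor C i).obj Q ⟶ X) := by
  let φ : ((HomotopyCategory.singleFunctor C i).obj Q ⟶ X) →ₗ[R]
      (Q ⟶ (HomotopyCategory.homologyFunctor C (ComplexShape.up ℤ) i).obj X) :=
    { toFun := homologyEval
      map_add' := homologyEval_add
      map_smul' := homologyEval_smul }
  exact isNoetherian_of_injective φ homologyEval_injective

lemma isNoetherian_hom_of_iso {D : Type*} [Category* D] [Preadditive D] [Linear R D] {X Y : D}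
    (e : X ≅ Y) (Z : D) [IsNoetherian R (X ⟶ Z)] : IsNoetherian R (Y ⟶ Z) :=
  isNoetherian_of_injective (Linear.leftComp R Z e.hom) fun _ _ h => (cancel_epi e.hom).1 h

lemma isNoetherian_obj₃_hom {D : Type*} [Category* D] [Preadditive D] [Linear R D]
    [HasZeroObject D] [HasShift D ℤ] [∀ n : ℤ, (shiftFunctor D n).Additive] [Pretriangulated D]
    {T : Triangle D} (hT : T ∈ distTriang D) (X : D) [IsNoetherian R (T.obj₂ ⟶ X)]
    [IsNoetherian R (T.obj₁⟦(1 : ℤ)⟧ ⟶ X)] : IsNoetherian R (T.obj₃ ⟶ X) := by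
  refine isNoetherian_of_range_eq_ker (Linear.leftComp R X T.mor₃) (Linear.leftComp R X T.mor₂) ?_
  ext f
  constructor
  · rintro ⟨g, rfl⟩
    change T.mor₂ ≫ T.mor₃ ≫ g = 0
    rw [comp_distTriang_mor_zero₂₃_assoc _ hT, zero_comp]
  · intro hf
    obtain ⟨g, hg⟩ := Triangle.yoneda_exact₃ T hT f hf
    exact ⟨g, hg.symm⟩

variable {P₁ P₀ : C} (d : P₁ ⟶ P₀) [Projective P₁] [Projective P₀]

variable (R) in
lemma isNoetherian_cone_hom (X : HomotopyCategory C (ComplexShape.up ℤ))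
    [IsNoetherian R (P₁ ⟶ (HomotopyCategory.homologyFunctor C (ComplexShape.up ℤ) (-1)).obj X)]
    [IsNoetherian R (P₀ ⟶ (HomotopyCategory.homologyFunctor C (ComplexShape.up ℤ) 0).obj X)] :
    IsNoetherian R ((coneTriangle d).obj₃ ⟶ X) := by
  have h₀ : IsNoetherian R ((coneTriangle d).obj₂ ⟶ X) := isNoetherian_single_hom R P₀ 0 X
  have h₁ := isNoetherian_single_hom R P₁ (-1) X
  have h₁' : IsNoetherian R ((coneTriangle d).obj₁⟦(1 : ℤ)⟧ ⟶ X) :=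
    -- P₁[1] is P₁ placed in degree -1, whence H⁻¹ in the hypotheses.
    isNoetherian_hom_of_iso (((HomotopyCategory.singleFunctors C).shiftIso 1 (-1) 0
      (by lia)).symm.app P₁) X
  exact isNoetherian_obj₃_hom (coneTriangle_distinguished d) X

end Linear

/-! ### Complexes with finitely generated homology, the ambient category for the approximations -/

section FiniteHomology

variable {A : Type u} [Ring A]

/-- The complexes whose homology modules are finitely generated. -/
def finiteHomology (A : Type u) [Ring A] : ObjectProperty (K A) :=
  fun X => ∀ n : ℤ, Module.Finite A
    ((HomotopyCategory.homologyFunctor (ModuleCat.{u} A) (ComplexShape.up ℤ) n).obj X)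

instance : (finiteHomology A).IsClosedUnderIsomorphisms where
  of_iso e h n :=
    have := h n
    Module.Finite.equiv ((HomotopyCategory.homologyFunctor (ModuleCat.{u} A)
      (ComplexShape.up ℤ) n).mapIso e).toLinearEquiv

instance [IsNoetherianRing A] : (finiteHomology A).IsTriangulated where
  exists_zero := ⟨_, isZero_zero (K A), fun n =>
    (finite_projective_of_isZero ((HomotopyCategory.homologyFunctor (ModuleCat.{u} A)
      (ComplexShape.up ℤ) n).map_isZero (isZero_zero _))).1⟩
  isStableUnderShiftBy a := ⟨fun X hX n =>
    have := hX (a + n)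
    Module.Finite.equiv (homologyShiftIso X a n (a + n) rfl).toLinearEquiv.symm⟩
  toIsTriangulatedClosed₂ := .mk' fun T hT h₁ h₃ n => by
    have := h₁ n
    have := h₃ n
    have hex := (HomotopyCategory.homologyFunctor (ModuleCat.{u} A)
      (ComplexShape.up ℤ) 0).homologySequence_exact₂ _ hT n
    have := isNoetherian_of_range_eq_ker
      ((HomotopyCategory.homologyFunctor (ModuleCat.{u} A) (ComplexShape.up ℤ) n).map T.mor₁).hom
      ((HomotopyCategory.homologyFunctor (ModuleCat.{u} A) (ComplexShape.up ℤ) n).map T.mor₂).hom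
      ((ShortComplex.moduleCat_exact_iff_range_eq_ker _).1 hex)
    infer_instance

lemma finiteHomology_stalk (M : ModuleCat.{u} A) [Module.Finite A M] :
    finiteHomology A (stalk M) := by
  intro n
  by_cases h : n = 0
  · subst h
    have : Module.Finite A ((𝟭 (ModuleCat.{u} A)).obj M) := ‹Module.Finite A M›
    exact Module.Finite.equiv
      ((singleCompHomologyIso (ModuleCat.{u} A) 0).app M).toLinearEquiv.symm
  · exact (finite_projective_of_isZero (isZero_homology_single M h)).1

lemma finiteHomology_cone [IsNoetherianRing A] {P₁ P₀ : ModuleCat.{u} A} (d : P₁ ⟶ P₀)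
    [Module.Finite A P₁] [Module.Finite A P₀] : finiteHomology A (cone d) :=
  (finiteHomology A).ext_of_isTriangulatedClosed₃ _ (coneTriangle_distinguished d)
    (finiteHomology_stalk P₁) (finiteHomology_stalk P₀)

lemma finiteHomology_biproduct {X : K A} (hX : finiteHomology A X) (n : ℕ) :
    finiteHomology A (⨁ fun _ : Fin n => X) := by
  intro i
  have := hX i
  have : Module.Finite A (ModuleCat.of A (∀ _ : Fin n,
      (HomotopyCategory.homologyFunctor (ModuleCat.{u} A) (ComplexShape.up ℤ) i).obj X)) :=
    Module.Finite.pi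
  exact Module.Finite.equiv (N := (HomotopyCategory.homologyFunctor (ModuleCat.{u} A)
    (ComplexShape.up ℤ) i).obj (⨁ fun _ : Fin n => X))
    (M := ModuleCat.of A (∀ _ : Fin n,
      (HomotopyCategory.homologyFunctor (ModuleCat.{u} A) (ComplexShape.up ℤ) i).obj X)) ((HomotopyCategory.homologyFunctor (ModuleCat.{u} A)
    (ComplexShape.up ℤ) i).mapBiproduct (fun _ : Fin n => X) ≪≫
      ModuleCat.biproductIsoPi _).toLinearEquiv.symm

end FiniteHomology

/-! ### The cone generates K^b(proj A) -/

section Generation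

open scoped ModuleCat.Algebra

lemma isNoetherian_moduleCat_hom (R : Type u) [CommRing R] [IsNoetherianRing R] {A : Type u}
    [Ring A] [Algebra R A] [Module.Finite R A] (Q M : ModuleCat.{u} A) [Module.Finite A Q] [Module.Finite A M] :
    IsNoetherian R (Q ⟶ M) := by
  have : Module.Finite R M := Module.Finite.trans A M
  obtain ⟨n, s, hs⟩ := Module.Finite.exists_fin (R := A) (M := Q)
  let φ : (Q ⟶ M) →ₗ[R] (Fin n → M) :=
    { toFun := fun f i => f.hom (s i)
      map_add' := fun _ _ => rfl
      map_smul' := fun _ _ => rfl }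
  refine isNoetherian_of_injective φ fun f g h => ModuleCat.hom_ext ?_
  refine LinearMap.ext_on_range hs fun i => congrFun h i

variable {A : Type u} [Ring A] {P₁ P₀ : ModuleCat.{u} A} (d : P₁ ⟶ P₀) [Module.Projective A P₁]
  [Module.Projective A P₀]

/-- Vanishing into G[1] makes H⁰G extend along d, and vanishing into G makes it detected along d, so
it lies in both classes. -/
lemma isZero_homology_of_forall_cone_eq_zero
    (hmeet : MeetInZero (extendsFG d.hom) (detectedFG d.hom)) {G : K A} (hG : finiteHomology A G)
    (h₀ : ∀ f : cone d ⟶ G, f = 0) (h₁ : ∀ f : cone d ⟶ G⟦(1 : ℤ)⟧, f = 0) :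
    IsZero ((HomotopyCategory.homologyFunctor (ModuleCat.{u} A) (ComplexShape.up ℤ) 0).obj G) := by
  have h₀' (f : cone d ⟶ G⟦(0 : ℤ)⟧) : f = 0 :=
    eq_zero_of_comp_iso ((shiftFunctorZero (K A) ℤ).app G) (h₀ _)
  refine (hmeet _).1 ⟨(extendsFG_iff _ _).2 ⟨?_, hG 0⟩, (detectedFG_iff _ _).2 ⟨?_, hG 0⟩⟩
  · exact (extendsAlong_hom_iff d _).2
      ((forall_cone_eq_zero_iff d G 0 1 (zero_add 1)).1 h₁).2
  · exact (detectedAlong_hom_iff d _).2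
      ((forall_cone_eq_zero_iff d G (-1) 0 (by lia)).1 h₀').1

lemma isTilting_cone (R : Type u) [CommRing R] [IsNoetherianRing R] [Algebra R A]
    [Module.Finite R A] [Module.Finite A P₁] [Module.Finite A P₀]
    (hmeet : MeetInZero (extendsFG d.hom) (detectedFG d.hom))
    (h₁ : ExtendsAlong d.hom (P₀ ⧸ LinearMap.range d.hom))
    (h₀ : DetectedAlong d.hom (LinearMap.ker d.hom)) : IsTilting (cone d) := by
  have : IsNoetherianRing A := isNoetherian_of_tower R inferInstance
  have hshift := (forall_cone_shift_eq_zero_iff d).2 ⟨h₁, h₀⟩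
  refine ⟨kbProj_cone d, hshift, fun S _ _ hS => ?_⟩
  have hstalk (Q : ModuleCat.{u} A) (hQ : Module.Finite A Q ∧ Module.Projective A Q) :
      S (stalk Q) := by
    have := hQ.1
    have := hQ.2
    -- The last condition holds because maps from Q to G are maps Q → H⁰G, and H⁰G = 0 for the
    -- obstruction G.
    refine prop_of_addClosure_le R (F := finiteHomology A) hS (fun X hX => ?_)
      (finiteHomology_biproduct (finiteHomology_cone d)) (finiteHomology_stalk Q)
      (hshift 1 (by lia)) (hshift 2 (by lia)) (fun G hG hG₀ hG₁ f => homologyEval_injective ?_)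
    · have := hX 0
      have := hX (-1)
      have := isNoetherian_moduleCat_hom R P₁ ((HomotopyCategory.homologyFunctor (ModuleCat.{u} A)
        (ComplexShape.up ℤ) (-1)).obj X)
      have := isNoetherian_moduleCat_hom R P₀ ((HomotopyCategory.homologyFunctor (ModuleCat.{u} A)
        (ComplexShape.up ℤ) 0).obj X)
      have := isNoetherian_cone_hom R d X
      infer_instance
    · exact (isZero_homology_of_forall_cone_eq_zero d hmeet hG hG₀ hG₁).eq_of_tgt _ _
  have hsingle (Q : ModuleCat.{u} A) (n : ℤ)
      (hQ : Module.Finite A Q ∧ Module.Projective A Q) :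
      S ((HomotopyCategory.singleFunctor (ModuleCat.{u} A) n).obj Q) :=
    S.prop_of_iso (((HomotopyCategory.singleFunctors (ModuleCat.{u} A)).shiftIso (-n) n 0
      (by lia)).app Q) (S.le_shift (-n) _ (hstalk Q hQ))
  rintro X ⟨L, hL, ⟨a, b, hab⟩, ⟨e⟩⟩
  let Z : ObjectProperty (ModuleCat.{u} A) :=
    fun M => Module.Finite A M ∧ Module.Projective A M
  have : Z.IsClosedUnderIsomorphisms := ⟨fun e h => finite_projective_of_iso e h⟩
  have : Z.ContainsZero := ⟨⟨_, isZero_zero _, finite_projective_of_isZero (isZero_zero _)⟩⟩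
  refine S.prop_of_iso e.symm (prop_quotient_of_bounded Z S
    (fun M hM => have := hM.2; inferInstance) (fun M n hM => hsingle M n hM)
    -- This is the number of degrees in [a, b], and 0 when the interval is empty.
    (b - a + 1).toNat b L hL fun n hn => hab n (by lia))

end Generation

lemma meetInZero_of_isTilting {A : Type u} [Ring A] {P₁ P₀ : ModuleCat.{u} A} (d : P₁ ⟶ P₀)
    [Module.Projective A P₁] [Module.Projective A P₀] (h : IsTilting (cone d)) :
    MeetInZero (extendsFG d.hom) (detectedFG d.hom) := by
  refine fun Z => ⟨fun hZ => ?_, fun hZ => ?_⟩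
  · have := h.subsingleton_of_extendsAlong_of_detectedAlong d hZ.1.1 hZ.2.1
    exact ModuleCat.isZero_of_subsingleton Z
  · have := ModuleCat.subsingleton_of_isZero hZ
    have := (finite_projective_of_isZero hZ).1
    exact ⟨⟨ExtendsAlong.of_subsingleton, this⟩, ⟨DetectedAlong.of_subsingleton, this⟩⟩

end TwoTerm

end

/-! ### Assembly of the equivalences -/

theorem proposition5p5
    {R : Type u} [CommRing R] [IsArtinianRing R]
    {I : Type u} [AddCommGroup I] [Module R I]
    (j : (R ⧸ Ring.jacobson R) →ₗ[R] I) (hj : TwoTerm.IsInjectiveEnvelope R j)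
    {A : Type u} [Ring A] [Algebra R A] [Module.Finite R A]
    [HasDerivedCategory.{w} (ModuleCat.{u} A)]
    {P₁ P₀ : ModuleCat.{u} A} [Module.Finite A P₁] [Module.Projective A P₁]
    [Module.Finite A P₀] [Module.Projective A P₀] (d : P₁ ⟶ P₀)
    (P : CochainComplex (ModuleCat.{u} A) ℤ) (hP : P = TwoTerm.twoTerm d) :
    List.TFAE [
      TwoTerm.IsTilting ((HomotopyCategory.quotient _ _).obj P),
      TwoTerm.MeetInZero (TwoTerm.classXc P) (TwoTerm.classYc P) ∧
        TwoTerm.classXc P (P.homology 0) ∧ TwoTerm.classYc P (P.homology (-1)),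
      TwoTerm.IsTorsionTheoryFG (TwoTerm.classXc P) (TwoTerm.classYc P) ∧
        TwoTerm.classYc P (P.homology (-1)),
      TwoTerm.IsTorsionTheoryFG (TwoTerm.classXc P) (TwoTerm.classYc P) ∧
        ∀ X : ModuleCat.{u} A, TwoTerm.classXc P X →
          TwoTerm.classXc P (TwoTerm.bimoduleTensor (TwoTerm.DualModule R A I) X),
      TwoTerm.IsTorsionTheoryFG (TwoTerm.classXc P) (TwoTerm.classYc P) ∧
        ∀ Y : ModuleCat.{u} A, TwoTerm.classYc P Y →
          TwoTerm.classYc P (TwoTerm.bimoduleHom (TwoTerm.DualModule R A I) Y)] := by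
  subst hP
  have hA : IsNoetherianRing A := isNoetherian_of_tower R inferInstance
  have hI := hj.isNoetherian
  have hDA := TwoTerm.finite_dualModule (R := R) (A := A) (I := I)
  have hX : TwoTerm.extendsFG d.hom ((TwoTerm.twoTerm d).homology 0) ↔
      TwoTerm.ExtendsAlong d.hom (P₀ ⧸ LinearMap.range d.hom) :=
    (and_iff_left (Module.Finite.equiv (TwoTerm.homologyTwoTermEquivQuotient d).symm)).trans
      (TwoTerm.ExtendsAlong.congr (TwoTerm.homologyTwoTermEquivQuotient d))
  have hY : TwoTerm.detectedFG d.hom ((TwoTerm.twoTerm d).homology (-1)) ↔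
      TwoTerm.DetectedAlong d.hom (LinearMap.ker d.hom) :=
    (and_iff_left (Module.Finite.equiv (TwoTerm.homologyTwoTermEquivKer d).symm)).trans
      (TwoTerm.DetectedAlong.congr (TwoTerm.homologyTwoTermEquivKer d))
  -- From here on, conditions 2 to 5 concern only the linear map d.
  rw [TwoTerm.classXc_twoTerm, TwoTerm.classYc_twoTerm, hX, hY]
  tfae_have 1 → 2 := fun h => ⟨TwoTerm.meetInZero_of_isTilting d h,
    (TwoTerm.forall_cone_shift_eq_zero_iff d).1 h.hom_shift_eq_zero⟩
  tfae_have 2 → 1 := fun h => TwoTerm.isTilting_cone d R h.1 h.2.1 h.2.2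
  tfae_have 2 ↔ 3 := by rw [TwoTerm.isTorsionTheoryFG_iff, and_assoc]
  tfae_have 3 ↔ 4 := and_congr_right fun h => h.detectedAlong_ker_iff hj
  tfae_have 4 ↔ 5 := and_congr_right fun h => h.tensor_stable_iff _
    fun Y _ _ _ => TwoTerm.finite_bimoduleHom_dualModule Y
  tfae_finish
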